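/- For a language (filter) $F$ over a finite alphabet $\{0,\dots,k-1\}$, let $\mathrm{RR}(F)$ be the problem: given (an encoding of) a deterministic finite automaton $\mathcal A$ over this alphabet, decide whether $L(\mathcal A)\cap F\neq\emptyset$. A finite-state transducer $T=(A,B,Q,q_0,\delta,Q_{\mathrm{acc}})$ with finite state set $Q$ and transition relation $\delta\subseteq Q\times(A\cup\{\varepsilon\})\times(B\cup\{\varepsilon\})\times Q$ is deterministic if every pair in $Q\times (A\cup\{\varepsilon\})$ admits at most one transition and no state has both a transition reading $\varepsilon$ and a transition reading a letter. Write $T(x)=y$ if some run of $T$ from $q_0$ to an accepting state reads $x$ and writes $y$, and let $T(F)=\{y \mid T(x)=y \text{ for some } x\in F\}$. Write $F_1\le_{\mathrm{dfst}}F_2$ if $F_1=T(F_2)$ for some deterministic finite-state transducer $T$, and let $\le_{\log}$ denote many-one reducibility by functions computable in deterministic logarithmic space. Let $F_1$ and $F_2$ be languages over finite alphabets. If $F_1\le_{\mathrm{dfst}}F_2$, then $\mathrm{RR}(F_1)\le_{\log}\mathrm{RR}(F_2)$. Moreover, for every deterministic finite-state transducer $T$ with $F_1=T(F_2)$ there is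 such a logspace reduction that maps every deterministic finite automaton $\mathcal A$ over the alphabet of $F_1$ to a deterministic finite automaton $\mathcal B$ over the alphabet of $F_2$ with $L(\mathcal B)=\{x\mid T(x)=y \text{ for some } y\in L(\mathcal A)\}$. -/

import Mathlib

/-! ## Finite-state transducers -/

/-- A finite-state transducer `(A, B, Q, q₀, δ, F)` with input alphabet `A` and output alphabet `B`.
The transition relation is `δ ⊆ Q × (A ∪ {ε}) × (B ∪ {ε}) × Q`; `none` stands for `ε`. -/
structure FST (A B : Type) where
  /-- the set of states -/
  Q : Type
  finite_Q : Finite Q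
  /-- the initial state -/
  start : Q
  /-- the transition relation -/
  trans : Set (Q × Option A × Option B × Q)
  /-- the set of accepting states -/
  accept : Set Q

namespace FST

variable {A B : Type}

/-- `T.Run q x y r`: there is a run of `T` from the state `q` to the state `r` that reads the
word `x` and writes the word `y`. -/
inductive Run (T : FST A B) : T.Q → List A → List B → T.Q → Prop
  | nil (q : T.Q) : Run T q [] [] q
  | cons {q r s : T.Q} {a : Option A} {b : Option B} {x : List A} {y : List B} :
      (q, a, b, r) ∈ T.trans → Run T r x y s → Run T q (a.toList ++ x) (b.toList ++ y) s

/-- `T` can transform the word `x` into the word `y` (in the usual notation, `T(x) = y`):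
some run that starts in the initial state, reads all of `x` and ends in an accepting state
writes `y`. -/
def Realizes (T : FST A B) (x : List A) (y : List B) : Prop :=
  ∃ q ∈ T.accept, T.Run T.start x y q

/-- The image `T(F)` of a language `F`. -/
def image (T : FST A B) (F : Language A) : Language B :=
  {y | ∃ x ∈ F, T.Realizes x y}

/-- `T` is deterministic: the next move is a (partial) function of the state and the next input
letter. So a state and an element of `A ∪ {ε}` admit at most one transition, and a state
with a transition that reads no input has no transition that reads a letter. -/
def IsDeterministic (T : FST A B) : Prop :=
  (∀ (q : T.Q) (a : Option A) (b b' : Option B) (r r' : T.Q),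
    (q, a, b, r) ∈ T.trans → (q, a, b', r') ∈ T.trans → b = b' ∧ r = r') ∧
  (∀ (q : T.Q) (a : A) (b b' : Option B) (r r' : T.Q),
    (q, none, b, r) ∈ T.trans → (q, some a, b', r') ∉ T.trans)

end FST

/-- `F₁ ≤ F₂` for deterministic finite-state transductions (`F₂` covers `F₁`):
`F₁ = T(F₂)` for some deterministic finite-state transducer `T`. -/
def DFSTReducible {A B : Type} (F₁ : Language B) (F₂ : Language A) : Prop :=
  ∃ T : FST A B, T.IsDeterministic ∧ F₁ = T.image F₂

/-! ## Turing machines with input, work and output tapes; logarithmic space -/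

/-- One step of a head. -/
inductive HeadMove
  | left
  | stay
  | right

/-- What the input head can read: an end marker or a letter of the input. -/
inductive InputSymbol (α : Type)
  | leftEnd
  | letter (a : α)
  | rightEnd

/-- A deterministic Turing machine with a two-way read-only input tape over `α`, finitely many
two-way infinite work tapes and a one-way write-only output tape over `β`. -/
structure OfflineTM (α β : Type) where
  /-- control states -/
  K : Type
  finite_K : Finite K
  /-- work alphabet -/
  Γ : Type
  finite_Γ : Finite Γ
  blank : Γ
  /-- number of work tapes -/
  numTapes : ℕ
  start : K
  /-- Given the control state and the scanned symbols, either halt (`none`), or give the new control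
  state, the move of the input head, the symbol written and the move on each work tape, and at most
  one symbol to be appended to the output. -/
  next : K → InputSymbol α → (Fin numTapes → Γ) →
    Option (K × HeadMove × (Fin numTapes → Γ × HeadMove) × Option β)

namespace OfflineTM

variable {α β : Type}

/-- Configurations of a machine (for a fixed input). Position `0` of the input tape holds the left
end marker, positions `1, …, |w|` hold the input `w`, and position `|w| + 1` holds the right end
marker. -/
structure Cfg (M : OfflineTM α β) where
  state : M.K
  inPos : ℕ
  work : Fin M.numTapes → ℤ → M.Γ
  pos : Fin M.numTapes → ℤ
  out : List β

/-- The symbol at a position of the input tape. -/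
def inputAt (w : List α) : ℕ → InputSymbol α
  | 0 => .leftEnd
  | i + 1 => match w[i]? with
    | some a => .letter a
    | none => .rightEnd

/-- A move of the input head, which cannot leave the part of the tape between the end markers. -/
def moveInput (w : List α) (i : ℕ) : HeadMove → ℕ
  | .left => i - 1
  | .stay => i
  | .right => min (i + 1) (w.length + 1)

/-- A move of the head of a work tape. -/
def moveWork (p : ℤ) : HeadMove → ℤ
  | .left => p - 1
  | .stay => p
  | .right => p + 1

/-- The initial configuration: input head on the left end marker, blank work tapes, no output. -/
def init (M : OfflineTM α β) : M.Cfg where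
  state := M.start
  inPos := 0
  work := fun _ _ => M.blank
  pos := fun _ => 0
  out := []

/-- One step of the computation on the input `w`; `none` means that the machine has halted. -/
def step (M : OfflineTM α β) (w : List α) (c : M.Cfg) : Option M.Cfg :=
  match M.next c.state (inputAt w c.inPos) (fun j => c.work j (c.pos j)) with
  | none => none
  | some (k, d, act, o) => some
      { state := k
        inPos := moveInput w c.inPos d
        work := fun j => Function.update (c.work j) (c.pos j) (act j).1
        pos := fun j => moveWork (c.pos j) (act j).2
        out := c.out ++ o.toList }

end OfflineTM

/-- `f` is computable in deterministic logarithmic space: some machine halts on every input `w`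
with output `f w`, and on every work tape its head stays within distance `O(log |w|)` of its
initial position throughout. -/
def LogspaceComputable {α β : Type} (f : List α → List β) : Prop :=
  ∃ (M : OfflineTM α β) (C : ℕ), ∀ w : List α,
    (∃ c : M.Cfg, StateTransition.Reaches (M.step w) M.init c ∧ M.step w c = none ∧
      c.out = f w) ∧
    ∀ c : M.Cfg, StateTransition.Reaches (M.step w) M.init c →
      ∀ j, |c.pos j| ≤ (C * (Nat.log 2 w.length + 1) : ℕ)

/-- `f` is a logspace many-one reduction of `L₁` to `L₂`. -/
def IsLogspaceReduction {α β : Type} (f : List α → List β) (L₁ : Language α) (L₂ : Language β) :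
    Prop :=
  LogspaceComputable f ∧ ∀ w, w ∈ L₁ ↔ f w ∈ L₂

/-- `L₁` is logspace many-one reducible to `L₂`. -/
def LogspaceReducible {α β : Type} (L₁ : Language α) (L₂ : Language β) : Prop :=
  ∃ f : List α → List β, IsLogspaceReduction f L₁ L₂

/-! ## Regular realizability problems -/

/-- The number `m`, written as `1 … 1 0` with `m` ones. -/
def unary (m : ℕ) : List Bool := List.replicate m true ++ [false]

open Classical in
/-- The binary word that describes a (complete) deterministic finite automaton with input alphabet
`{0, …, k - 1}` and states `{0, …, n - 1}`: the number of states, the initial state, and then for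
each state in turn the bit that tells whether it is accepting, followed by its successors under the
letters `0, …, k - 1`. -/
noncomputable def encodeDFA {k n : ℕ} (A : DFA (Fin k) (Fin n)) : List Bool :=
  unary n ++ unary A.start ++
    (List.finRange n).flatMap fun q =>
      decide (q ∈ A.accept) :: (List.finRange k).flatMap fun a => unary (A.step q a)

/-- The regular realizability problem `RR(F)`: given a deterministic finite automaton `A`, decide
whether `L(A) ∩ F` is nonempty. -/
def RR {k : ℕ} (F : Language (Fin k)) : Language Bool :=
  {w | ∃ (n : ℕ) (A : DFA (Fin k) (Fin n)), w = encodeDFA A ∧ ∃ x, x ∈ A.accepts ∧ x ∈ F}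

/-!
Let `T` be a deterministic transducer with `F₁ = T(F₂)`. For an automaton `A`, the words that `T` can
transform into a word of `L(A)` are accepted by a product `B` of `T` and `A`, and `L(B)` meets `F₂`
if and only if `L(A)` meets `T(F₂) = F₁`. So it suffices that `B` is deterministic and that its
encoding can be computed from the encoding of `A` in logarithmic space.

*The product.* Since `T` is deterministic, its next letter move is determined by the state and the
letter, including the transitions before it that read nothing. After the input has been read, `T` may
still follow transitions that read nothing, perhaps forever, and accept at various moments; as this
walk runs into a cycle, what it can write then is a finite union of languages `u v*`. This gives the
sequential form of `T` (`FST.IsDeterministic.exists_seqTransducer`), and the product with `A`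
(`SeqTransducer.pullback`) is an ordinary complete automaton. Its accepting states are computable:
if `u v^t` leads to acceptance in `A` for some `t`, then for some `t` below the number of states of
`A` (`DFA.exists_evalFrom_pow_iff`).

*Logarithmic space.* The reduction is written as a structured program over finitely many registers,
each holding a number of at most the input length plus one, with a two-way input head
(`RegProg`, with big-step semantics `Exec`). Such a program is compiled to a Turing machine with one
work tape, whose `j`-th cell holds the `j`-th binary digits of all registers at once. Every register
operation and every test of a register is then a single sweep over the tape with a one-bit carry,
followed by the return to the home position. The control states are the lists of programs that
remain to be executed; only finitely many of them occur. See `Exec.boundedReach` and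
`logspaceComputable_of_exec`.

*The program.* It checks that the input encodes an automaton (`RegProg.triple_validate`), writing
nothing if not, and then writes the product state by state (`RegProg.triple_emitPullback`); the
states of the fixed transducer are unrolled in the program text, those of `A` are held in registers.
A successor in `A` is found by walking through the input to the description of the state.
-/

/-! ### Register programs -/

/-- Operations on registers that hold natural numbers. -/
inductive RegOp (ι : Type)
  | inc (i : ι)
  | dec (i : ι)
  /-- `copy i j` assigns the value of register `j` to register `i`. -/
  | copy (i j : ι)
  | clear (i : ι)

/-- Conditions that a register program can test. -/
inductive RegTest (ι α : Type)
  /-- register `i` is positive -/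
  | pos (i : ι)
  /-- the scanned input symbol satisfies `p` -/
  | sees (p : InputSymbol α → Bool)

/-- Structured programs that work on registers indexed by `ι`, a two-way input head over `α` and an
output over `β`. -/
inductive RegProg (ι α β : Type)
  | skip
  | move (d : HeadMove)
  | emit (b : β)
  | op (o : RegOp ι)
  | seq (a b : RegProg ι α β)
  | branch (t : RegTest ι α) (a b : RegProg ι α β)
  | loop (t : RegTest ι α) (a : RegProg ι α β)

/-- The data of a register program: position of the input head, registers and output. -/
structure RegState (ι β : Type) where
  pos : ℕ
  reg : ι → ℕ
  out : List β

section RegisterPrograms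

variable {ι α β : Type}

/-- The new contents of the registers. -/
def RegOp.eval [DecidableEq ι] (r : ι → ℕ) : RegOp ι → ι → ℕ
  | .inc i => Function.update r i (r i + 1)
  | .dec i => Function.update r i (r i - 1)
  | .copy i j => Function.update r i (r j)
  | .clear i => Function.update r i 0

/-- An operation is admissible if it does not decrement zero and keeps the registers at most `N`. -/
def RegOp.Admissible (N : ℕ) (r : ι → ℕ) : RegOp ι → Prop
  | .inc i => r i < N
  | .dec i => 0 < r i
  | _ => True

/-- The truth value of a test. -/
def RegTest.eval (w : List α) (s : RegState ι β) : RegTest ι α → Bool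
  | .pos i => decide (0 < s.reg i)
  | .sees p => p (OfflineTM.inputAt w s.pos)

/-- Big-step semantics: `Exec w N c s s'` says that on the input `w` the program `c` terminates from
`s` in `s'`, and that all registers stay at most `N` if they are so in `s`. -/
inductive Exec [DecidableEq ι] (w : List α) (N : ℕ) :
    RegProg ι α β → RegState ι β → RegState ι β → Prop
  | skip (s) : Exec w N .skip s s
  | move (d s) : Exec w N (.move d) s { s with pos := OfflineTM.moveInput w s.pos d }
  | emit (b s) : Exec w N (.emit b) s { s with out := s.out ++ [b] }
  | op (o s) : o.Admissible N s.reg → Exec w N (.op o) s { s with reg := o.eval s.reg }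
  | seq {a b s s' s''} : Exec w N a s s' → Exec w N b s' s'' → Exec w N (.seq a b) s s''
  | branchTrue {t a b s s'} : t.eval w s = true → Exec w N a s s' →
      Exec w N (.branch t a b) s s'
  | branchFalse {t a b s s'} : t.eval w s = false → Exec w N b s s' →
      Exec w N (.branch t a b) s s'
  | loopTrue {t a s s' s''} : t.eval w s = true → Exec w N a s s' →
      Exec w N (.loop t a) s' s'' → Exec w N (.loop t a) s s''
  | loopFalse {t a s} : t.eval w s = false → Exec w N (.loop t a) s s

theorem RegOp.eval_le [DecidableEq ι] {N : ℕ} {r : ι → ℕ} {o : RegOp ι} (ho : o.Admissible N r)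
    (hr : ∀ i, r i ≤ N) (i : ι) : o.eval r i ≤ N := by
  cases o with
  | inc j => by_cases h : i = j <;> simp_all [RegOp.eval, RegOp.Admissible]
  | dec j =>
    simp only [RegOp.eval, Function.update_apply]
    split_ifs
    · exact (Nat.sub_le _ _).trans (hr j)
    · exact hr i
  | copy j k => by_cases h : i = j <;> simp_all [RegOp.eval]
  | clear j => by_cases h : i = j <;> simp_all [RegOp.eval]

/-! ### Sweeps over binary counters -/

/-- The rule of a sweep: from a carry and a column of bits (one bit for each register), compute the
new carry and the new column. -/
abbrev SweepRule (ι : Type) := Bool → (ι → Bool) → Bool × (ι → Bool)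

open Classical in
/-- A sweep over a list of columns, least significant bits first. The rule is applied once more
beyond the last column, and the resulting column is kept only if it has a nonzero bit. -/
noncomputable def sweep (f : SweepRule ι) : Bool → List (ι → Bool) → Bool × List (ι → Bool)
  | c, [] => ((f c fun _ => false).1,
      if (f c fun _ => false).2 = (fun _ => false) then [] else [(f c fun _ => false).2])
  | c, x :: xs => ((sweep f (f c x).1 xs).1, (f c x).2 :: (sweep f (f c x).1 xs).2)

/-- The number that a list of columns holds in register `i`. -/
def colValue : List (ι → Bool) → ι → ℕ
  | [], _ => 0
  | x :: xs, i => (x i).toNat + 2 * colValue xs i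

/-- The sweep that performs an operation. -/
def RegOp.rule [DecidableEq ι] : RegOp ι → SweepRule ι
  | .inc i => fun c x => (c && x i, Function.update x i (c ^^ x i))
  | .dec i => fun c x => (c && !x i, Function.update x i (c ^^ x i))
  | .copy i j => fun c x => (c, Function.update x i (x j))
  | .clear i => fun c x => (c, Function.update x i false)

/-- The carry with which the sweep of an operation starts. -/
def RegOp.carry : RegOp ι → Bool
  | .inc _ => true
  | .dec _ => true
  | _ => false

theorem colValue_sweep_nil (f : SweepRule ι) (c : Bool) (i : ι) :
    colValue (sweep f c []).2 i = ((f c fun _ => false).2 i).toNat := by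
  simp only [sweep]
  split_ifs with h
  · simp [colValue, h]
  · simp [colValue]

theorem colValue_sweep_cons (f : SweepRule ι) (c : Bool) (x : ι → Bool) (xs : List (ι → Bool))
    (i : ι) : colValue (sweep f c (x :: xs)).2 i =
      ((f c x).2 i).toNat + 2 * colValue (sweep f (f c x).1 xs).2 i := rfl

theorem colValue_sweep_inc [DecidableEq ι] (i j : ι) (cols : List (ι → Bool)) (c : Bool) :
    colValue (sweep (RegOp.inc i).rule c cols).2 j =
      colValue cols j + if j = i then c.toNat else 0 := by
  induction cols generalizing c with
  | nil =>
    rw [colValue_sweep_nil]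
    by_cases h : j = i <;> simp [RegOp.rule, colValue, h]
  | cons x xs ih =>
    rw [colValue_sweep_cons, ih]
    by_cases h : j = i
    · subst h
      cases c <;> cases hx : x j <;> simp [RegOp.rule, colValue, hx]
      all_goals omega
    · simp [RegOp.rule, colValue, h]

theorem colValue_sweep_dec [DecidableEq ι] (i j : ι) (cols : List (ι → Bool)) (c : Bool)
    (hc : c.toNat ≤ colValue cols i) :
    colValue (sweep (RegOp.dec i).rule c cols).2 j =
      colValue cols j - if j = i then c.toNat else 0 := by
  induction cols generalizing c with
  | nil =>
    rw [colValue_sweep_nil]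
    have : c = false := by cases c <;> simp_all [colValue]
    by_cases h : j = i <;> simp [RegOp.rule, colValue, h, this]
  | cons x xs ih =>
    rw [colValue_sweep_cons, ih]
    · by_cases h : j = i
      · subst h
        cases c <;> cases hx : x j <;> simp [RegOp.rule, colValue, hx] at hc ⊢
        omega
      · simp [RegOp.rule, colValue, h]
    · cases c <;> cases hx : x i <;> simp [RegOp.rule, colValue, hx] at hc ⊢
      omega

theorem colValue_sweep_copy [DecidableEq ι] (i j a : ι) (cols : List (ι → Bool)) (c : Bool) :
    colValue (sweep (RegOp.copy i j).rule c cols).2 a =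
      if a = i then colValue cols j else colValue cols a := by
  induction cols generalizing c with
  | nil =>
    rw [colValue_sweep_nil]
    by_cases h : a = i <;> simp [RegOp.rule, colValue, h]
  | cons x xs ih =>
    rw [colValue_sweep_cons, ih]
    by_cases h : a = i <;> simp [RegOp.rule, colValue, h]

theorem colValue_sweep_clear [DecidableEq ι] (i a : ι) (cols : List (ι → Bool)) (c : Bool) :
    colValue (sweep (RegOp.clear i).rule c cols).2 a = if a = i then 0 else colValue cols a := by
  induction cols generalizing c with
  | nil =>
    rw [colValue_sweep_nil]
    by_cases h : a = i <;> simp [RegOp.rule, colValue, h]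
  | cons x xs ih =>
    rw [colValue_sweep_cons, ih]
    by_cases h : a = i <;> simp [RegOp.rule, colValue, h]

/-- Sweeping performs the operation on the numbers that the columns hold. -/
theorem RegOp.colValue_sweep [DecidableEq ι] {N : ℕ} (o : RegOp ι) (cols : List (ι → Bool))
    (ho : o.Admissible N (colValue cols)) :
    colValue (sweep o.rule o.carry cols).2 = o.eval (colValue cols) := by
  funext a
  cases o with
  | inc i =>
    rw [colValue_sweep_inc]
    by_cases h : a = i <;> simp [RegOp.eval, RegOp.carry, h]
  | dec i =>
    rw [RegOp.carry, colValue_sweep_dec i a cols true ho]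
    by_cases h : a = i <;> simp [RegOp.eval, h]
  | copy i j =>
    rw [colValue_sweep_copy]
    by_cases h : a = i <;> simp [RegOp.eval, h]
  | clear i =>
    rw [colValue_sweep_clear]
    by_cases h : a = i <;> simp [RegOp.eval, h]

/-- The sweep that tests whether register `i` is positive: it changes no column and ends with the
answer as its carry. -/
def posRule (i : ι) : SweepRule ι := fun c x => (c || x i, x)

theorem sweep_posRule (i : ι) (cols : List (ι → Bool)) (c : Bool) :
    sweep (posRule i) c cols = (c || decide (0 < colValue cols i), cols) := by
  induction cols generalizing c with
  | nil => simp [sweep, posRule, colValue]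
  | cons x xs ih =>
    simp only [sweep, ih]
    cases c <;> cases hx : x i <;> simp [posRule, colValue, hx]

/-- A sweep adds a column only if some register needs it. -/
theorem length_sweep (f : SweepRule ι) (c : Bool) (cols : List (ι → Bool)) :
    (sweep f c cols).2.length = cols.length ∨
      (sweep f c cols).2.length = cols.length + 1 ∧
        ∃ i, 2 ^ cols.length ≤ colValue (sweep f c cols).2 i := by
  induction cols generalizing c with
  | nil =>
    simp only [sweep]
    split_ifs with h
    · simp
    · right
      obtain ⟨i, hi⟩ := Function.ne_iff.1 h
      refine ⟨by simp, i, ?_⟩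
      simp only [ne_eq, Bool.not_eq_false] at hi
      simp [colValue, hi]
  | cons x xs ih =>
    rcases ih (f c x).1 with h | ⟨h, i, hi⟩
    · left; simp [sweep, h]
    · right
      refine ⟨by simp [sweep, h], i, ?_⟩
      simp only [sweep, colValue, List.length_cons, pow_succ]
      omega

theorem length_sweep_le {N : ℕ} {f : SweepRule ι} {c : Bool} {cols : List (ι → Bool)}
    (hl : cols.length ≤ Nat.log 2 N + 1) (hN : ∀ i, colValue (sweep f c cols).2 i ≤ N) :
    (sweep f c cols).2.length ≤ Nat.log 2 N + 1 := by
  rcases length_sweep f c cols with h | ⟨h, i, hi⟩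
  · omega
  · have := Nat.le_log_of_pow_le one_lt_two (hi.trans (hN i))
    omega

end RegisterPrograms

/-! ### Compiling register programs to Turing machines -/

section Compilation

variable {ι α β : Type}

/-- Control states of the machine that runs a register program. A list of programs in `L` is what
remains to be done. -/
inductive Control (L ι : Type)
  /-- about to execute `l`, with the work head at its home position -/
  | fetch (l : L)
  /-- sweeping to the right with carry `c`, then to continue with `l` or `l'` according to the
  final carry -/
  | right (f : SweepRule ι) (c : Bool) (l l' : L)
  /-- returning to the home position -/
  | left (l : L)

/-- The lists of programs that can remain when `c` is executed before `rest`. -/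
def continuations : RegProg ι α β → List (RegProg ι α β) → Set (List (RegProg ι α β))
  | .seq a b, rest => {.seq a b :: rest} ∪ (continuations a (b :: rest) ∪ continuations b rest)
  | .branch t a b, rest =>
      {.branch t a b :: rest} ∪ (continuations a rest ∪ continuations b rest)
  | .loop t a, rest => {.loop t a :: rest, rest} ∪ continuations a (.loop t a :: rest)
  | c, rest => {c :: rest, rest}

theorem finite_continuations (c : RegProg ι α β) (rest : List (RegProg ι α β)) :
    (continuations c rest).Finite := by
  induction c generalizing rest with
  | seq a b iha ihb => exact (Set.finite_singleton _).union ((iha _).union (ihb _))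
  | branch t a b iha ihb => exact (Set.finite_singleton _).union ((iha _).union (ihb _))
  | loop t a iha => exact (Set.toFinite _).union (iha _)
  | _ => exact Set.toFinite {_, rest}

theorem cons_mem_continuations (c : RegProg ι α β) (rest : List (RegProg ι α β)) :
    c :: rest ∈ continuations c rest := by
  cases c <;> simp [continuations]

/-- The lists of programs that may come next. -/
def successors : List (RegProg ι α β) → Set (List (RegProg ι α β))
  | [] => ∅
  | .seq a b :: rest => {a :: b :: rest}
  | .branch _ a b :: rest => {a :: rest, b :: rest}
  | .loop t a :: rest => {a :: .loop t a :: rest, rest}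
  | _ :: rest => {rest}

theorem successors_subset_continuations (c : RegProg ι α β) (rest : List (RegProg ι α β)) :
    ∀ x ∈ continuations c rest, x = rest ∨ successors x ⊆ continuations c rest := by
  induction c generalizing rest with
  | seq a b iha ihb =>
    rintro x (rfl | h | h)
    · right
      rintro y rfl
      exact Or.inr (Or.inl (cons_mem_continuations _ _))
    · right
      rcases iha _ x h with rfl | h
      · rcases ihb rest _ (cons_mem_continuations b rest) with h | h
        · simp at h
        · exact fun y hy => Or.inr (Or.inr (h hy))
      · exact fun y hy => Or.inr (Or.inl (h hy))
    · exact (ihb _ x h).imp_right fun h y hy => Or.inr (Or.inr (h hy))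
  | branch t a b iha ihb =>
    rintro x (rfl | h | h)
    · right
      rintro y (rfl | rfl)
      · exact Or.inr (Or.inl (cons_mem_continuations _ _))
      · exact Or.inr (Or.inr (cons_mem_continuations _ _))
    · exact (iha _ x h).imp_right fun h y hy => Or.inr (Or.inl (h hy))
    · exact (ihb _ x h).imp_right fun h y hy => Or.inr (Or.inr (h hy))
  | loop t a iha =>
    have key : successors (.loop t a :: rest) ⊆ continuations (.loop t a) rest := by
      rintro y (rfl | rfl)
      · exact Or.inr (cons_mem_continuations _ _)
      · exact Or.inl (Or.inr rfl)
    rintro x ((rfl | rfl) | h)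
    · exact Or.inr key
    · exact Or.inl rfl
    · right
      rcases iha _ x h with rfl | h
      · exact key
      · exact fun y hy => Or.inr (h hy)
  | _ =>
    rintro x (rfl | rfl)
    · right
      rintro y rfl
      exact Or.inr rfl
    · exact Or.inl rfl

/-- The lists of programs mentioned in a control state belong to `p`. -/
def Control.All {L : Type} (p : Set L) : Control L ι → Prop
  | .fetch l => l ∈ p
  | .right _ _ l l' => l ∈ p ∧ l' ∈ p
  | .left l => l ∈ p

theorem Control.finite_all [Finite ι] {L : Type} {p : Set L} (hp : p.Finite) :
    {k : Control L ι | k.All p}.Finite := by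
  refine Set.Finite.subset (s := Control.fetch '' p ∪ Control.left '' p ∪
    (fun x : SweepRule ι × Bool × L × L => Control.right x.1 x.2.1 x.2.2.1 x.2.2.2) ''
      (Set.univ ×ˢ Set.univ ×ˢ p ×ˢ p)) ?_ ?_
  · refine ((hp.image _).union (hp.image _)).union (Set.Finite.image _ ?_)
    exact Set.finite_univ.prod (Set.finite_univ.prod (hp.prod hp))
  · rintro (l | ⟨f, c, l, l'⟩ | l) h
    · exact Or.inl (Or.inl ⟨l, h, rfl⟩)
    · exact Or.inr ⟨(f, c, l, l'), ⟨trivial, trivial, h.1, h.2⟩, rfl⟩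
    · exact Or.inl (Or.inr ⟨l, h, rfl⟩)

/-- What a control state does: the next control state, the move of the input head, the symbol
written on the work tape with the move of its head, and the output. A cell of the work tape is
blank (`none`) or holds a column of bits. -/
noncomputable def controlNext [DecidableEq ι] : Control (List (RegProg ι α β)) ι → InputSymbol α →
    Option (ι → Bool) → Option (Control (List (RegProg ι α β)) ι × HeadMove ×
      (Option (ι → Bool) × HeadMove) × Option β)
  | .fetch [], _, _ => none
  | .fetch (.skip :: l), _, g => some (.fetch l, .stay, (g, .stay), none)
  | .fetch (.move d :: l), _, g => some (.fetch l, d, (g, .stay), none)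
  | .fetch (.emit b :: l), _, g => some (.fetch l, .stay, (g, .stay), some b)
  | .fetch (.op o :: l), _, g => some (.right o.rule o.carry l l, .stay, (g, .right), none)
  | .fetch (.seq a b :: l), _, g => some (.fetch (a :: b :: l), .stay, (g, .stay), none)
  | .fetch (.branch (.pos i) a b :: l), _, g =>
      some (.right (posRule i) false (a :: l) (b :: l), .stay, (g, .right), none)
  | .fetch (.branch (.sees p) a b :: l), x, g =>
      some (.fetch (if p x then a :: l else b :: l), .stay, (g, .stay), none)
  | .fetch (.loop (.pos i) a :: l), _, g =>
      some (.right (posRule i) false (a :: .loop (.pos i) a :: l) l, .stay, (g, .right), none)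
  | .fetch (.loop (.sees p) a :: l), x, g =>
      some (.fetch (if p x then a :: .loop (.sees p) a :: l else l), .stay, (g, .stay), none)
  | .right f c l l', _, some g =>
      some (.right f (f c g).1 l l', .stay, (some (f c g).2, .right), none)
  | .right f c l l', _, none =>
      some (.left (if (sweep f c []).1 then l else l'), .stay,
        ((sweep f c []).2.head?, .left), none)
  | .left l, _, some g => some (.left l, .stay, (some g, .left), none)
  | .left l, _, none => some (.fetch l, .stay, (none, .stay), none)

theorem controlNext_all [DecidableEq ι] {p : Set (List (RegProg ι α β))}
    (hp : ∀ l ∈ p, successors l ⊆ p)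
    {k : Control (List (RegProg ι α β)) ι} (hk : k.All p) {x : InputSymbol α}
    {g : Option (ι → Bool)} {r} (h : controlNext k x g = some r) : r.1.All p := by
  rcases k with (_ | ⟨c, l⟩) | ⟨f, c, l, l'⟩ | l
  · simp [controlNext] at h
  · have hs := hp _ hk
    rcases c with _ | _ | _ | _ | _ | ⟨_ | _⟩ | ⟨_ | _⟩ <;>
      simp only [controlNext, Option.some.injEq] at h <;> subst h <;>
      simp only [Control.All] <;> try split_ifs
    all_goals first
      | exact hs (by simp [successors])
      | exact ⟨hs (by simp [successors]), hs (by simp [successors])⟩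
  · cases g <;> simp only [controlNext, Option.some.injEq] at h <;> subst h
    · simp only [Control.All]
      split_ifs
      exacts [hk.1, hk.2]
    · exact hk
  · cases g <;> simp only [controlNext, Option.some.injEq] at h <;> subst h <;> exact hk

open Classical in
/-- The Turing machine that runs the program `c` on a single work tape. -/
noncomputable def RegProg.machine [DecidableEq ι] [Finite ι] (c : RegProg ι α β) :
    OfflineTM α β where
  K := {k : Control (List (RegProg ι α β)) ι // k.All (continuations c [])}
  finite_K := (Control.finite_all (finite_continuations c [])).to_subtype
  Γ := Option (ι → Bool)
  finite_Γ := inferInstance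
  blank := none
  numTapes := 1
  start := ⟨.fetch [c], cons_mem_continuations c []⟩
  next k x g := (controlNext k.1 x (g 0)).bind fun r =>
    if h : r.1.All (continuations c []) then some (⟨r.1, h⟩, r.2.1, fun _ => r.2.2.1, r.2.2.2)
    else none

/-- The control states of the machine are closed under its transitions, since the empty list of
programs has no successor. -/
theorem successors_subset (c : RegProg ι α β) :
    ∀ l ∈ continuations c [], successors l ⊆ continuations c [] := by
  intro l hl
  rcases successors_subset_continuations c [] l hl with rfl | h
  · simp [successors]
  · exact h

/-- Configurations of the machine, without the restriction to the control states that can occur. -/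
structure ControlCfg (ι α β : Type) where
  state : Control (List (RegProg ι α β)) ι
  inPos : ℕ
  work : ℤ → Option (ι → Bool)
  pos : ℤ
  out : List β

/-- A step from a configuration with work head within distance `B` of its initial position. -/
def BoundedStep [DecidableEq ι] (w : List α) (B : ℕ) (a b : ControlCfg ι α β) : Prop :=
  |a.pos| ≤ B ∧ ∃ r, controlNext a.state (OfflineTM.inputAt w a.inPos) (a.work a.pos) = some r ∧
    b = ⟨r.1, OfflineTM.moveInput w a.inPos r.2.1, Function.update a.work a.pos r.2.2.1.1,
      OfflineTM.moveWork a.pos r.2.2.1.2, a.out ++ r.2.2.2.toList⟩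

/-- A computation that keeps the work head within distance `B` of its initial position. -/
abbrev BoundedReach [DecidableEq ι] (w : List α) (B : ℕ) :
    ControlCfg ι α β → ControlCfg ι α β → Prop :=
  Relation.ReflTransGen (BoundedStep w B)

/-- Work tape with the given columns to the right of the home position. -/
def columnTape (cols : List (ι → Bool)) (z : ℤ) : Option (ι → Bool) :=
  if z ≤ 0 then none else cols[(z - 1).toNat]?

theorem columnTape_append (pre : List (ι → Bool)) (x : ι → Bool) (cols : List (ι → Bool)) :
    columnTape (pre ++ x :: cols) (pre.length + 1) = some x := by
  have h : ¬ ((pre.length : ℤ) + 1 ≤ 0) := by omega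
  simp [columnTape, h]

theorem columnTape_length (pre : List (ι → Bool)) :
    columnTape pre (pre.length + 1) = none := by
  simp [columnTape]

theorem update_columnTape (pre : List (ι → Bool)) (x y : ι → Bool) (cols : List (ι → Bool)) :
    Function.update (columnTape (pre ++ x :: cols)) (pre.length + 1) (some y) =
      columnTape (pre ++ y :: cols) := by
  funext z
  by_cases hz : z = pre.length + 1
  · subst hz
    rw [columnTape_append, Function.update_self]
  · rw [Function.update_of_ne hz]
    unfold columnTape
    split_ifs with h
    · rfl
    · rcases lt_or_ge (z - 1).toNat pre.length with h' | h'
      · rw [List.getElem?_append_left h', List.getElem?_append_left h']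
      · rw [List.getElem?_append_right h', List.getElem?_append_right h']
        obtain ⟨m, hm⟩ : ∃ m, (z - 1).toNat - pre.length = m + 1 :=
          ⟨(z - 1).toNat - pre.length - 1, by omega⟩
        rw [hm, List.getElem?_cons_succ, List.getElem?_cons_succ]

theorem update_columnTape_length (pre : List (ι → Bool)) (o : Option (ι → Bool)) :
    Function.update (columnTape pre) (pre.length + 1) o = columnTape (pre ++ o.toList) := by
  funext z
  by_cases hz : z = pre.length + 1
  · subst hz
    rw [Function.update_self]
    cases o with
    | none => simp [columnTape_length]
    | some x => simpa using (columnTape_append pre x []).symm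
  · rw [Function.update_of_ne hz]
    unfold columnTape
    split_ifs with h
    · rfl
    · rcases lt_or_ge (z - 1).toNat pre.length with h' | h'
      · rw [List.getElem?_append_left h']
      · have : pre.length + 1 ≤ (z - 1).toNat := by omega
        rw [List.getElem?_eq_none (by omega), List.getElem?_eq_none]
        cases o <;> simp <;> omega

theorem boundedReach_right [DecidableEq ι] (w : List α) (B : ℕ) (f : SweepRule ι)
    (l l' : List (RegProg ι α β))
    (i : ℕ) (out : List β) (cols : List (ι → Bool)) :
    ∀ (c : Bool) (pre : List (ι → Bool)), pre.length + cols.length + 1 ≤ B →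
    BoundedReach w B ⟨.right f c l l', i, columnTape (pre ++ cols), pre.length + 1, out⟩
      ⟨.left (if (sweep f c cols).1 then l else l'), i, columnTape (pre ++ (sweep f c cols).2),
        (pre.length + cols.length : ℕ), out⟩ := by
  induction cols with
  | nil =>
    intro c pre hB
    refine Relation.ReflTransGen.single ⟨?_, ?_⟩
    · simp only [List.length_nil] at hB
      dsimp only
      rw [abs_of_nonneg (by omega)]
      exact_mod_cast hB
    · rw [List.append_nil]
      dsimp only
      rw [columnTape_length]
      refine ⟨_, rfl, ?_⟩
      have : (sweep f c []).2.head?.toList = (sweep f c []).2 := by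
        simp only [sweep]; split_ifs <;> rfl
      simp [OfflineTM.moveInput, OfflineTM.moveWork, update_columnTape_length, this]
  | cons x cols ih =>
    intro c pre hB
    refine Relation.ReflTransGen.head (b := ⟨.right f (f c x).1 l l', i,
      columnTape ((pre ++ [(f c x).2]) ++ cols), (pre ++ [(f c x).2]).length + 1, out⟩)
      ⟨?_, ?_⟩ ?_
    · simp only [List.length_cons] at hB
      dsimp only
      rw [abs_of_nonneg (by omega)]
      omega
    · dsimp only
      rw [columnTape_append]
      refine ⟨_, rfl, ?_⟩
      simp [OfflineTM.moveInput, OfflineTM.moveWork, update_columnTape]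
    · have := ih (f c x).1 (pre ++ [(f c x).2]) (by simp at hB ⊢; omega)
      rw [List.append_assoc pre _ (sweep f (f c x).1 cols).2, Nat.cast_add] at this
      rw [List.length_cons, Nat.add_comm cols.length, ← Nat.add_assoc, Nat.cast_add]
      rw [List.length_append] at this ⊢
      exact this

theorem boundedReach_left [DecidableEq ι] (w : List α) (B : ℕ) (l : List (RegProg ι α β))
    (i : ℕ) (out : List β) (cols : List (ι → Bool)) (j : ℕ) (hj : j ≤ cols.length) (hB : j ≤ B) :
    BoundedReach w B ⟨.left l, i, columnTape cols, j, out⟩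
      ⟨.fetch l, i, columnTape cols, 0, out⟩ := by
  induction j with
  | zero =>
    refine Relation.ReflTransGen.single ⟨by simp, ?_⟩
    have h : columnTape cols ((0 : ℕ) : ℤ) = none := by simp [columnTape]
    dsimp only
    rw [h]
    refine ⟨_, rfl, ?_⟩
    rw [← h]
    simp [OfflineTM.moveInput, OfflineTM.moveWork]
  | succ j ih =>
    refine Relation.ReflTransGen.head (b := ⟨.left l, i, columnTape cols, j, out⟩) ⟨?_, ?_⟩
      (ih (by omega) (by omega))
    · dsimp only
      rw [abs_of_nonneg (by omega)]
      exact_mod_cast hB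
    · have h : columnTape cols ((j + 1 : ℕ) : ℤ) = some cols[j] := by
        have h : ¬ ((j : ℤ) + 1 ≤ 0) := by omega
        simp [columnTape, h]
      dsimp only
      rw [h]
      refine ⟨_, rfl, ?_⟩
      rw [← h]
      simp [OfflineTM.moveInput, OfflineTM.moveWork]

/-- A complete sweep: to the right end of the columns and back. -/
theorem boundedReach_sweep [DecidableEq ι] (w : List α) {B : ℕ} {c : RegProg ι α β}
    {rest l l' : List (RegProg ι α β)}
    {i : ℕ} {out : List β} {cols : List (ι → Bool)} {f : SweepRule ι} {b : Bool}
    (hB : cols.length + 1 ≤ B)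
    (hc : ∀ x g, controlNext (.fetch (c :: rest)) x g =
      some (.right f b l l', .stay, (g, .right), none)) :
    BoundedReach w B ⟨.fetch (c :: rest), i, columnTape cols, 0, out⟩
      ⟨.fetch (if (sweep f b cols).1 then l else l'), i, columnTape (sweep f b cols).2, 0,
        out⟩ := by
  refine Relation.ReflTransGen.head (b := ⟨.right f b l l', i, columnTape cols, 1, out⟩)
    ⟨by simp, ?_⟩ ?_
  · refine ⟨_, hc _ _, ?_⟩
    simp [OfflineTM.moveInput, OfflineTM.moveWork]
  · have h := boundedReach_right w B f l l' i out cols b [] (by simpa using hB)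
    simp only [List.length_nil, List.nil_append, Nat.cast_zero, zero_add] at h
    refine h.trans (boundedReach_left _ _ _ _ _ _ _ ?_ (by omega))
    rcases length_sweep f b cols with h | h <;> omega

/-- A command that is executed in a single step of the machine, without touching the work tape. -/
theorem boundedReach_single [DecidableEq ι] (w : List α) (B : ℕ) {c : RegProg ι α β}
    {rest l : List (RegProg ι α β)}
    {i : ℕ} {out : List β} {t : ℤ → Option (ι → Bool)} {d : HeadMove} {o : Option β}
    (hc : ∀ g, controlNext (.fetch (c :: rest)) (OfflineTM.inputAt w i) g =
      some (.fetch l, d, (g, .stay), o)) :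
    BoundedReach w B ⟨.fetch (c :: rest), i, t, 0, out⟩
      ⟨.fetch l, OfflineTM.moveInput w i d, t, 0, out ++ o.toList⟩ := by
  refine Relation.ReflTransGen.single ⟨by simp, _, hc _, ?_⟩
  simp [OfflineTM.moveWork]

/-- The work tape holds the registers `r`, and has at most as many columns as numbers up to `N`
need. -/
def Holds (N : ℕ) (cols : List (ι → Bool)) (r : ι → ℕ) : Prop :=
  colValue cols = r ∧ cols.length ≤ Nat.log 2 N + 1 ∧ ∀ i, r i ≤ N

/-- The machine evaluates a test: tests of a register need a sweep, tests of the input a single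
step. -/
theorem boundedReach_test [DecidableEq ι] (w : List α) {N : ℕ} {c : RegProg ι α β}
    {rest l l' : List (RegProg ι α β)} {s : RegState ι β} {cols : List (ι → Bool)}
    (t : RegTest ι α) (h : Holds N cols s.reg)
    (hpos : ∀ i, t = .pos i → ∀ x g, controlNext (.fetch (c :: rest)) x g =
      some (.right (posRule i) false l l', .stay, (g, .right), none))
    (hsees : ∀ p, t = .sees p → ∀ x g, controlNext (.fetch (c :: rest)) x g =
      some (.fetch (if p x then l else l'), .stay, (g, .stay), none)) :
    BoundedReach w (Nat.log 2 N + 2) ⟨.fetch (c :: rest), s.pos, columnTape cols, 0, s.out⟩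
      ⟨.fetch (if t.eval w s then l else l'), s.pos, columnTape cols, 0, s.out⟩ := by
  obtain ⟨h1, h2, -⟩ := h
  cases t with
  | pos i =>
    have := boundedReach_sweep (i := s.pos) (out := s.out) w
      (by omega : cols.length + 1 ≤ Nat.log 2 N + 2) (hpos i rfl)
    rwa [sweep_posRule, h1, Bool.false_or] at this
  | sees p =>
    have := boundedReach_single (out := s.out) (t := columnTape cols) (o := none) w
      (Nat.log 2 N + 2) (fun g => hsees p rfl (OfflineTM.inputAt w s.pos) g)
    rw [Option.toList_none, List.append_nil] at this
    exact this

/-- The machine follows the big-step semantics. -/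
theorem Exec.boundedReach [DecidableEq ι] {w : List α} {N : ℕ} {c : RegProg ι α β}
    {s s' : RegState ι β} (h : Exec w N c s s') :
    ∀ cols, Holds N cols s.reg → ∃ cols', Holds N cols' s'.reg ∧
      ∀ rest, BoundedReach w (Nat.log 2 N + 2)
        ⟨.fetch (c :: rest), s.pos, columnTape cols, 0, s.out⟩
        ⟨.fetch rest, s'.pos, columnTape cols', 0, s'.out⟩ := by
  induction h with
  | skip s =>
    refine fun cols hc => ⟨cols, hc, fun rest => ?_⟩
    simpa [OfflineTM.moveInput] using boundedReach_single (l := rest) (d := .stay) (o := none) w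
      (Nat.log 2 N + 2) (fun g => rfl)
  | move d s =>
    refine fun cols hc => ⟨cols, hc, fun rest => ?_⟩
    simpa using boundedReach_single (l := rest) (d := d) (o := none) w
      (Nat.log 2 N + 2) (fun g => rfl)
  | emit b s =>
    refine fun cols hc => ⟨cols, hc, fun rest => ?_⟩
    simpa [OfflineTM.moveInput] using boundedReach_single (l := rest) (d := .stay) (o := some b) w
      (Nat.log 2 N + 2) (fun g => rfl)
  | op o s ho =>
    rintro cols ⟨h1, h2, h3⟩
    have hv : colValue (sweep o.rule o.carry cols).2 = o.eval s.reg := by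
      rw [o.colValue_sweep cols (h1 ▸ ho), h1]
    have hle : ∀ i, o.eval s.reg i ≤ N := RegOp.eval_le ho h3
    refine ⟨_, ⟨hv, length_sweep_le h2 (by rwa [hv]), hle⟩, fun rest => ?_⟩
    simpa using boundedReach_sweep (rest := rest) (l := rest) (l' := rest) (c := .op o) w
      (by omega : cols.length + 1 ≤ Nat.log 2 N + 2) (fun _ _ => rfl)
  | seq _ _ iha ihb =>
    intro cols hc
    obtain ⟨cols1, hc1, h1⟩ := iha cols hc
    obtain ⟨cols2, hc2, h2⟩ := ihb cols1 hc1
    refine ⟨cols2, hc2, fun rest => Relation.ReflTransGen.trans ?_ ((h1 _).trans (h2 _))⟩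
    simpa [OfflineTM.moveInput] using boundedReach_single (d := .stay) (o := none) w
      (Nat.log 2 N + 2) (fun g => rfl)
  | @branchTrue t a b s s' ht _ ih =>
    intro cols hc
    obtain ⟨cols1, hc1, h1⟩ := ih cols hc
    refine ⟨cols1, hc1, fun rest => Relation.ReflTransGen.trans ?_ (h1 _)⟩
    simpa [ht] using boundedReach_test w t (c := .branch t a b) (l := a :: rest) (l' := b :: rest)
      hc (by rintro i rfl _ _; rfl) (by rintro p rfl _ _; rfl)
  | @branchFalse t a b s s' ht _ ih =>
    intro cols hc
    obtain ⟨cols1, hc1, h1⟩ := ih cols hc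
    refine ⟨cols1, hc1, fun rest => Relation.ReflTransGen.trans ?_ (h1 _)⟩
    simpa [ht] using boundedReach_test w t (c := .branch t a b) (l := a :: rest) (l' := b :: rest)
      hc (by rintro i rfl _ _; rfl) (by rintro p rfl _ _; rfl)
  | @loopTrue t a s s' s'' ht _ _ iha ihb =>
    intro cols hc
    obtain ⟨cols1, hc1, h1⟩ := iha cols hc
    obtain ⟨cols2, hc2, h2⟩ := ihb cols1 hc1
    refine ⟨cols2, hc2, fun rest => Relation.ReflTransGen.trans ?_ ((h1 _).trans (h2 _))⟩
    simpa [ht] using boundedReach_test w t (c := .loop t a) (l := a :: .loop t a :: rest)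
      (l' := rest) hc (by rintro i rfl _ _; rfl) (by rintro p rfl _ _; rfl)
  | @loopFalse t a s ht =>
    refine fun cols hc => ⟨cols, hc, fun rest => ?_⟩
    simpa [ht] using boundedReach_test w t (c := .loop t a) (l := a :: .loop t a :: rest)
      (l' := rest) hc (by rintro i rfl _ _; rfl) (by rintro p rfl _ _; rfl)

/-- A configuration of the machine, from the unrestricted one. -/
def ControlCfg.toCfg [DecidableEq ι] [Finite ι] {c : RegProg ι α β} (a : ControlCfg ι α β)
    (ha : a.state.All (continuations c [])) : c.machine.Cfg where
  state := ⟨a.state, ha⟩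
  inPos := a.inPos
  work := fun _ => a.work
  pos := fun _ => a.pos
  out := a.out

theorem BoundedStep.step_eq [DecidableEq ι] [Finite ι] {c : RegProg ι α β} {w : List α} {B : ℕ}
    {a b : ControlCfg ι α β} (h : BoundedStep w B a b) (ha : a.state.All (continuations c [])) :
    ∃ hb : b.state.All (continuations c []), c.machine.step w (a.toCfg ha) = some (b.toCfg hb) := by
  obtain ⟨_, r, hr, rfl⟩ := h
  have hb := controlNext_all (successors_subset c) ha hr
  refine ⟨hb, ?_⟩
  have hn : c.machine.next ⟨a.state, ha⟩ (OfflineTM.inputAt w a.inPos) (fun _ => a.work a.pos) =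
      some (⟨r.1, hb⟩, r.2.1, fun _ => r.2.2.1, r.2.2.2) := by
    simp [RegProg.machine, hr, hb]
  simp only [OfflineTM.step, ControlCfg.toCfg]
  rw [hn]
  rfl

/-- If the computation halts in a configuration `b` without exceeding the bound, then the machine
halts there, and all its configurations satisfy the bound. -/
theorem BoundedReach.reaches [DecidableEq ι] [Finite ι] {c : RegProg ι α β} {w : List α} {B : ℕ}
    {a b : ControlCfg ι α β} (h : BoundedReach w B a b) (hpos : b.pos = 0)
    (hb : b.state = .fetch []) (ha : a.state.All (continuations c [])) :
    (∃ d : c.machine.Cfg, StateTransition.Reaches (c.machine.step w) (a.toCfg ha) d ∧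
      c.machine.step w d = none ∧ d.out = b.out) ∧
    ∀ d, StateTransition.Reaches (c.machine.step w) (a.toCfg ha) d → ∀ j, |d.pos j| ≤ B := by
  induction h using Relation.ReflTransGen.head_induction_on with
  | refl =>
    have hstep : c.machine.step w (b.toCfg ha) = none := by
      obtain ⟨s, i, t, z, o⟩ := b
      subst hb
      simp [OfflineTM.step, ControlCfg.toCfg, RegProg.machine, controlNext]
    refine ⟨⟨_, Relation.ReflTransGen.refl, hstep, rfl⟩, fun d hd j => ?_⟩
    rcases Relation.ReflTransGen.cases_head hd with rfl | ⟨e, he, _⟩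
    · simp [ControlCfg.toCfg, hpos]
    · simp [hstep] at he
  | @head a a' hstep _ ih =>
    obtain ⟨ha', hs⟩ := hstep.step_eq ha
    obtain ⟨⟨d, hd, hd'⟩, hall⟩ := ih ha'
    refine ⟨⟨d, Relation.ReflTransGen.head hs hd, hd'⟩, fun d hd j => ?_⟩
    rcases Relation.ReflTransGen.cases_head hd with rfl | ⟨e, he, hed⟩
    · exact hstep.1
    · rw [hs] at he
      cases he
      exact hall d hed j

/-- Register programs whose registers are bounded by the length of the input run in logarithmic
space. -/
theorem logspaceComputable_of_exec [DecidableEq ι] [Finite ι] {f : List α → List β}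
    (c : RegProg ι α β)
    (h : ∀ w, ∃ s, Exec w (w.length + 1) c ⟨0, fun _ => 0, []⟩ s ∧ s.out = f w) :
    LogspaceComputable f := by
  -- The head stays within `log (|w| + 1) + 2 ≤ 3 * (log |w| + 1)`.
  refine ⟨c.machine, 3, fun w => ?_⟩
  obtain ⟨s, hs, hf⟩ := h w
  obtain ⟨cols', -, hr⟩ := hs.boundedReach [] ⟨rfl, by simp, by simp⟩
  have ht : columnTape ([] : List (ι → Bool)) = fun _ => none := by
    funext z; simp [columnTape]
  obtain ⟨⟨d, hd, hd', hout⟩, hall⟩ :=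
    (hr []).reaches (c := c) rfl rfl (cons_mem_continuations c [])
  have hinit : ControlCfg.toCfg (c := c) ⟨.fetch [c], 0, columnTape [], 0, []⟩
      (cons_mem_continuations c []) = c.machine.init := by
    simp only [ControlCfg.toCfg, OfflineTM.init, ht]
    rfl
  rw [hinit] at hd hall
  refine ⟨⟨d, hd, hd', hout.trans hf⟩, fun d hd j => (hall d hd j).trans ?_⟩
  have hlog : Nat.log 2 (w.length + 1) ≤ Nat.log 2 w.length + 1 := by
    rcases Nat.eq_zero_or_pos w.length with h0 | h0
    · simp [h0]
    · rw [← Nat.log_mul_base one_lt_two h0.ne']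
      exact Nat.log_mono_right (by omega)
  push_cast
  omega

end Compilation

/-! ### Deterministic transducers in sequential form -/

namespace FST

section Determinism

variable {A B : Type} {T : FST A B}

theorem Run.append {q r s : T.Q} {x x' : List A} {y y' : List B} (h : T.Run q x y r)
    (h' : T.Run r x' y' s) : T.Run q (x ++ x') (y ++ y') s := by
  induction h with
  | nil => exact h'
  | cons ht _ ih =>
    rw [List.append_assoc, List.append_assoc]
    exact .cons ht (ih h')

theorem Run.nil_cases {q s : T.Q} {y : List B} (h : T.Run q [] y s) :
    (q = s ∧ y = []) ∨ ∃ b r y', (q, none, b, r) ∈ T.trans ∧ T.Run r [] y' s ∧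
      y = b.toList ++ y' := by
  generalize hx : ([] : List A) = x at h
  cases h with
  | nil => exact Or.inl ⟨rfl, rfl⟩
  | @cons _ r _ a b x y ht hr =>
    cases a with
    | none =>
      obtain rfl : [] = x := by simpa using hx
      exact Or.inr ⟨b, r, y, ht, hr, rfl⟩
    | some a => simp at hx

/-- Induction along runs that read nothing. -/
theorem Run.nil_induction {P : T.Q → List B → T.Q → Prop} (hnil : ∀ q, P q [] q)
    (hcons : ∀ q b r y s, (q, none, b, r) ∈ T.trans → T.Run r [] y s → P r y s →
      P q (b.toList ++ y) s) {q s : T.Q} {y : List B} (h : T.Run q [] y s) : P q y s := by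
  generalize hx : ([] : List A) = x at h
  induction h with
  | nil => exact hnil _
  | @cons q r s a b x y ht hr ih =>
    cases a with
    | none =>
      obtain rfl : [] = x := by simpa using hx
      exact hcons _ _ _ _ _ ht hr (ih rfl)
    | some a => simp at hx

/-- `T` can move from `q` to `r` by transitions that read nothing, followed by one that reads the
letter `a`, and write `z` on the way. -/
def LetterMove (T : FST A B) (q : T.Q) (a : A) (z : List B) (r : T.Q) : Prop :=
  ∃ z' q' b, T.Run q [] z' q' ∧ (q', some a, b, r) ∈ T.trans ∧ z = z' ++ b.toList

theorem run_cons_iff {q s : T.Q} {a : A} {x : List A} {y : List B} :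
    T.Run q (a :: x) y s ↔ ∃ z r y', T.LetterMove q a z r ∧ T.Run r x y' s ∧ y = z ++ y' := by
  constructor
  · intro h
    generalize hx : a :: x = x' at h
    induction h with
    | nil => simp at hx
    | @cons q r s a' b x' y' ht hr ih =>
      cases a' with
      | none =>
        obtain ⟨z, r', y'', ⟨z', q', b', h1, h2, rfl⟩, h3, rfl⟩ := ih (by simpa using hx)
        refine ⟨_, r', y'', ⟨_, q', b', .cons ht h1, h2, rfl⟩, h3, ?_⟩
        simp
      | some a' =>
        simp only [Option.toList_some, List.singleton_append, List.cons.injEq] at hx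
        obtain ⟨rfl, rfl⟩ := hx
        exact ⟨b.toList, r, y', ⟨[], q, b, .nil q, ht, rfl⟩, hr, rfl⟩
  · rintro ⟨_, r, y', ⟨z', q', b, h1, h2, rfl⟩, h3, rfl⟩
    rw [List.append_assoc]
    exact h1.append (.cons h2 h3)

theorem LetterMove.unique (hT : T.IsDeterministic) {q r r' : T.Q} {a : A} {z z' : List B}
    (h : T.LetterMove q a z r) (h' : T.LetterMove q a z' r') : z = z' ∧ r = r' := by
  have key : ∀ {q q₁ : T.Q} {y₁ : List B}, T.Run q [] y₁ q₁ → ∀ {b₁ r₁ y₂ q₂ b₂ r₂},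
      (q₁, some a, b₁, r₁) ∈ T.trans → T.Run q [] y₂ q₂ → (q₂, some a, b₂, r₂) ∈ T.trans →
      y₁ = y₂ ∧ q₁ = q₂ := by
    intro q q₁ y₁ h
    refine Run.nil_induction (T := T) (P := fun q y₁ q₁ => ∀ {b₁ r₁ y₂ q₂ b₂ r₂},
      (q₁, some a, b₁, r₁) ∈ T.trans → T.Run q [] y₂ q₂ → (q₂, some a, b₂, r₂) ∈ T.trans →
      y₁ = y₂ ∧ q₁ = q₂) ?_ ?_ h
    · intro q b₁ r₁ y₂ q₂ b₂ r₂ h1 h2 h3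
      rcases h2.nil_cases with ⟨rfl, rfl⟩ | ⟨b, r, y', h4, -, -⟩
      · exact ⟨rfl, rfl⟩
      · exact absurd h1 (hT.2 _ _ _ _ _ _ h4)
    · intro q b r y s ht _ ih b₁ r₁ y₂ q₂ b₂ r₂ h1 h2 h3
      rcases h2.nil_cases with ⟨rfl, rfl⟩ | ⟨b', r', y', h4, h5, rfl⟩
      · exact absurd h3 (hT.2 _ _ _ _ _ _ ht)
      · obtain ⟨rfl, rfl⟩ := hT.1 _ _ _ _ _ _ ht h4
        obtain ⟨rfl, rfl⟩ := ih h1 h5 h3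
        exact ⟨rfl, rfl⟩
  obtain ⟨z₁, q₁, b₁, h1, h2, rfl⟩ := h
  obtain ⟨z₂, q₂, b₂, h3, h4, rfl⟩ := h'
  obtain ⟨rfl, rfl⟩ := key h1 h2 h3 h4
  obtain ⟨rfl, rfl⟩ := hT.1 _ _ _ _ _ _ h2 h4
  exact ⟨rfl, rfl⟩

open Classical in
/-- The transition out of a state that reads nothing, as a total function: the next state and the
output. The state `none` stands for having no such transition. -/
noncomputable def silent (T : FST A B) : Option T.Q → Option T.Q × List B
  | none => (none, [])
  | some q =>
    if h : ∃ p : Option B × T.Q, (q, none, p.1, p.2) ∈ T.trans then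
      (some h.choose.2, h.choose.1.toList)
    else (none, [])

theorem silent_eq (hT : T.IsDeterministic) {q r : T.Q} {b : Option B}
    (h : (q, none, b, r) ∈ T.trans) : T.silent (some q) = (some r, b.toList) := by
  have hex : ∃ p : Option B × T.Q, (q, none, p.1, p.2) ∈ T.trans := ⟨(b, r), h⟩
  obtain ⟨h1, h2⟩ := hT.1 _ _ _ _ _ _ hex.choose_spec h
  simp only [silent, dif_pos hex, h1, h2]

/-- The state after `j` transitions that read nothing. -/
noncomputable def silentState (T : FST A B) (j : ℕ) (q : Option T.Q) : Option T.Q :=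
  (fun c => (T.silent c).1)^[j] q

/-- The output of the first `j` transitions that read nothing. -/
noncomputable def silentOut (T : FST A B) : ℕ → Option T.Q → List B
  | 0, _ => []
  | j + 1, q => (T.silent q).2 ++ T.silentOut j (T.silent q).1

theorem silentState_add (i j : ℕ) (q : Option T.Q) :
    T.silentState (i + j) q = T.silentState j (T.silentState i q) := by
  rw [Nat.add_comm]
  exact Function.iterate_add_apply _ _ _ _

theorem silentOut_add (i j : ℕ) (q : Option T.Q) :
    T.silentOut (i + j) q = T.silentOut i q ++ T.silentOut j (T.silentState i q) := by
  induction i generalizing q with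
  | zero => simp [silentOut, silentState]
  | succ i ih =>
    rw [Nat.add_right_comm, silentOut, ih, silentOut, List.append_assoc]
    rfl

theorem silentState_none (j : ℕ) : T.silentState j none = none :=
  Function.iterate_fixed rfl j

theorem run_nil_iff (hT : T.IsDeterministic) {q s : T.Q} {y : List B} :
    T.Run q [] y s ↔ ∃ j, T.silentState j (some q) = some s ∧ y = T.silentOut j (some q) := by
  constructor
  · refine Run.nil_induction (P := fun q y s => ∃ j, T.silentState j (some q) = some s ∧
      y = T.silentOut j (some q)) (fun q => ⟨0, rfl, rfl⟩) ?_
    rintro q b r y s ht - ⟨j, h1, rfl⟩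
    refine ⟨j + 1, ?_, ?_⟩
    · rw [Nat.add_comm, silentState_add]
      simpa [silentState, silent_eq hT ht] using h1
    · simp [silentOut, silent_eq hT ht]
  · rintro ⟨j, h1, rfl⟩
    induction j generalizing q with
    | zero =>
      obtain rfl : q = s := by simpa [silentState] using h1
      exact .nil q
    | succ j ih =>
      by_cases h : ∃ p : Option B × T.Q, (q, none, p.1, p.2) ∈ T.trans
      · obtain ⟨⟨b, r⟩, h⟩ := h
        rw [Nat.add_comm, silentState_add] at h1
        rw [silentOut, silent_eq hT h]
        refine Run.cons (a := none) (x := []) h (ih ?_)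
        simpa [silentState, silent_eq hT h] using h1
      · rw [Nat.add_comm, silentState_add] at h1
        have : T.silentState 1 (some q) = none := by simp [silentState, silent, h]
        rw [this, silentState_none] at h1
        simp at h1

/-- What a deterministic transducer can write without reading, ending in an accepting state, is a
finite union of languages `u v*`: the walk along the transitions that read nothing runs into a
cycle. -/
theorem exists_final_outputs (hT : T.IsDeterministic) (q : Option T.Q) :
    ∃ E : List (List B × List B), ∀ y,
      (∃ p, q = some p ∧ ∃ s ∈ T.accept, T.Run p [] y s) ↔
        ∃ uv ∈ E, ∃ t, y = uv.1 ++ (List.replicate t uv.2).flatten := by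
  classical
  have := T.finite_Q
  rcases q with _ | q
  · exact ⟨[], by simp⟩
  obtain ⟨i, j, hij, hs⟩ :=
    Finite.exists_ne_map_eq_of_infinite (fun j => T.silentState j (some q))
  wlog hlt : i < j generalizing i j
  · exact this j i hij.symm hs.symm (by omega)
  obtain ⟨p, rfl⟩ : ∃ p, j = i + (p + 1) := ⟨j - i - 1, by omega⟩
  set L := p + 1 with hL
  have hper : ∀ a, i ≤ a → T.silentState (a + L) (some q) = T.silentState a (some q) := by
    intro a ha
    obtain ⟨d, rfl⟩ : ∃ d, a = i + d := ⟨a - i, by omega⟩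
    rw [Nat.add_right_comm, silentState_add, ← hs, ← silentState_add]
  have hpow : ∀ a, i ≤ a → ∀ t, T.silentState (a + t * L) (some q) = T.silentState a (some q) ∧
      T.silentOut (a + t * L) (some q) = T.silentOut a (some q) ++
        (List.replicate t (T.silentOut L (T.silentState a (some q)))).flatten := by
    intro a ha t
    induction t with
    | zero => simp
    | succ t ih =>
      rw [Nat.succ_mul, ← Nat.add_assoc]
      refine ⟨(hper _ (by omega)).trans ih.1, ?_⟩
      rw [silentOut_add, ih.1, ih.2, List.replicate_succ', List.flatten_append, List.append_assoc]
      simp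
  let E : List (List B × List B) := ((List.range (i + L)).filter fun a =>
    decide (∃ s ∈ T.accept, T.silentState a (some q) = some s)).map fun a =>
      (T.silentOut a (some q),
        if a < i then [] else T.silentOut L (T.silentState a (some q)))
  refine ⟨E, fun y => ?_⟩
  simp only [E, List.mem_map, List.mem_filter, List.mem_range, decide_eq_true_eq]
  constructor
  · rintro ⟨q', hq', s, hs, hr⟩
    obtain rfl : q = q' := Option.some.inj hq'
    obtain ⟨a, ha, rfl⟩ := (run_nil_iff hT).1 hr
    rcases lt_or_ge a i with hai | hai
    · exact ⟨_, ⟨a, ⟨by omega, s, hs, ha⟩, rfl⟩, 0, by simp⟩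
    · have hdecomp : a = (i + (a - i) % L) + (a - i) / L * L := by
        have := Nat.mod_add_div (a - i) L
        rw [Nat.mul_comm] at this
        omega
      have hmod : (a - i) % L < L := Nat.mod_lt _ (by omega)
      obtain ⟨h1, h2⟩ := hpow (i + (a - i) % L) (by omega) ((a - i) / L)
      rw [← hdecomp] at h1 h2
      refine ⟨_, ⟨_, ⟨by omega, s, hs, h1.symm.trans ha⟩, rfl⟩, (a - i) / L, ?_⟩
      rw [h2, if_neg (by omega)]
  · rintro ⟨_, ⟨a, ⟨ha, s, hs, has⟩, rfl⟩, t, rfl⟩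
    refine ⟨q, rfl, s, hs, (run_nil_iff hT).2 ?_⟩
    dsimp only
    split_ifs with hai
    · exact ⟨a, has, by simp⟩
    · obtain ⟨h1, h2⟩ := hpow a (by omega) t
      exact ⟨a + t * L, h1.trans has, h2.symm⟩

end Determinism

end FST

/-- A sequential transducer: each input letter determines the next state and an output word. After
the input, it writes any word of a finite union of languages `u v*` that depends on the state. -/
structure SeqTransducer (l k : ℕ) where
  /-- number of states -/
  m : ℕ
  start : Fin m
  next : Fin m → Fin l → Fin m
  out : Fin m → Fin l → List (Fin k)
  /-- the pairs `(u, v)` -/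
  final : Fin m → List (List (Fin k) × List (Fin k))

/-- `S.Produces q x y`: started in the state `q`, the transducer can transform `x` into `y`. -/
def SeqTransducer.Produces {l k : ℕ} (S : SeqTransducer l k) :
    Fin S.m → List (Fin l) → List (Fin k) → Prop
  | q, [], y => ∃ uv ∈ S.final q, ∃ t, y = uv.1 ++ (List.replicate t uv.2).flatten
  | q, a :: x, y => ∃ y', y = S.out q a ++ y' ∧ S.Produces (S.next q a) x y'

/-- Every deterministic transducer has a sequential form. -/
theorem FST.IsDeterministic.exists_seqTransducer {l k : ℕ} {T : FST (Fin l) (Fin k)}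
    (hT : T.IsDeterministic) :
    ∃ S : SeqTransducer l k, ∀ x y, T.Realizes x y ↔ S.Produces S.start x y := by
  classical
  have := T.finite_Q
  obtain ⟨m, ⟨e⟩⟩ := Finite.exists_equiv_fin (Option T.Q)
  choose E hE using fun q => FST.exists_final_outputs hT q
  -- The value `none` is the state in which no letter can be read any more.
  let g : Option T.Q → Fin l → Option T.Q × List (Fin k) := fun q a =>
    if h : ∃ p : List (Fin k) × T.Q, ∃ q', q = some q' ∧ T.LetterMove q' a p.1 p.2 then
      (some h.choose.2, h.choose.1)
    else (none, [])
  have hg : ∀ {q a z r}, T.LetterMove q a z r → g (some q) a = (some r, z) := by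
    intro q a z r h
    have hex : ∃ p : List (Fin k) × T.Q, ∃ q', some q = some q' ∧ T.LetterMove q' a p.1 p.2 :=
      ⟨(z, r), q, rfl, h⟩
    obtain ⟨q', hq', h'⟩ := hex.choose_spec
    cases hq'
    obtain ⟨h1, h2⟩ := h'.unique hT h
    simp only [g, dif_pos hex, h1, h2]
  have hg' : ∀ {q a}, (¬ ∃ p : List (Fin k) × T.Q, ∃ q', q = some q' ∧ T.LetterMove q' a p.1 p.2) →
      g q a = (none, []) := fun h => dif_neg h
  let S : SeqTransducer l k :=
    { m := m
      start := e (some T.start)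
      next := fun q a => e (g (e.symm q) a).1
      out := fun q a => (g (e.symm q) a).2
      final := fun q => E (e.symm q) }
  refine ⟨S, ?_⟩
  have key : ∀ x y q, (∃ p, q = some p ∧ ∃ s ∈ T.accept, T.Run p x y s) ↔
      S.Produces (e q) x y := by
    intro x
    induction x with
    | nil =>
      intro y q
      rw [hE q y]
      simp [SeqTransducer.Produces, S]
    | cons a x ih =>
      intro y q
      simp only [SeqTransducer.Produces, S, Equiv.symm_apply_apply]
      constructor
      · rintro ⟨p, rfl, s, hs, hr⟩
        obtain ⟨z, r, y', hz, hr', rfl⟩ := FST.run_cons_iff.1 hr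
        refine ⟨y', ?_, ?_⟩
        · rw [hg hz]
        · rw [hg hz]
          exact (ih y' (some r)).1 ⟨r, rfl, s, hs, hr'⟩
      · rintro ⟨y', rfl, h⟩
        obtain ⟨r, hr, s, hs, hrun⟩ := (ih y' _).2 h
        by_cases hex : ∃ p : List (Fin k) × T.Q, ∃ q', q = some q' ∧ T.LetterMove q' a p.1 p.2
        · obtain ⟨⟨z, r'⟩, q', rfl, hz⟩ := hex
          rw [hg hz] at hr ⊢
          cases hr
          exact ⟨q', rfl, s, hs, FST.run_cons_iff.2 ⟨z, r', y', hz, hrun, rfl⟩⟩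
        · rw [hg' hex] at hr
          simp at hr
  intro x y
  rw [show S.start = e (some T.start) from rfl, ← key]
  simp [FST.Realizes]

/-! ### The product of a transducer and an automaton -/

section Product

variable {l k : ℕ}

open Classical in
/-- The automaton that accepts the words which the transducer `S` can transform into a word accepted
by `A`. The pair of the state `q` of `S` and the state `p` of `A` is numbered `p + n * q`. -/
noncomputable def SeqTransducer.pullback (S : SeqTransducer l k) {n : ℕ} (A : DFA (Fin k) (Fin n)) :
    DFA (Fin l) (Fin (S.m * n)) where
  start := finProdFinEquiv (S.start, A.start)
  step c a := finProdFinEquiv (S.next (finProdFinEquiv.symm c).1 a,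
    A.evalFrom (finProdFinEquiv.symm c).2 (S.out (finProdFinEquiv.symm c).1 a))
  accept := {c | ∃ uv ∈ S.final (finProdFinEquiv.symm c).1, ∃ t,
    A.evalFrom (finProdFinEquiv.symm c).2 (uv.1 ++ (List.replicate t uv.2).flatten) ∈ A.accept}

theorem SeqTransducer.mem_accepts_pullback (S : SeqTransducer l k) {n : ℕ}
    (A : DFA (Fin k) (Fin n)) (x : List (Fin l)) :
    x ∈ (S.pullback A).accepts ↔ ∃ y, S.Produces S.start x y ∧ y ∈ A.accepts := by
  have key : ∀ (x : List (Fin l)) (q : Fin S.m) (p : Fin n),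
      (S.pullback A).evalFrom (finProdFinEquiv (q, p)) x ∈ (S.pullback A).accept ↔
        ∃ y, S.Produces q x y ∧ A.evalFrom p y ∈ A.accept := by
    intro x
    induction x with
    | nil =>
      intro q p
      simp only [DFA.evalFrom_nil, SeqTransducer.pullback, Set.mem_ofPred_eq,
        Equiv.symm_apply_apply, SeqTransducer.Produces]
      constructor
      · rintro ⟨uv, huv, t, ht⟩
        exact ⟨_, ⟨uv, huv, t, rfl⟩, ht⟩
      · rintro ⟨_, ⟨uv, huv, t, rfl⟩, ht⟩
        exact ⟨uv, huv, t, ht⟩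
    | cons a x ih =>
      intro q p
      have hstep : (S.pullback A).step (finProdFinEquiv (q, p)) a =
          finProdFinEquiv (S.next q a, A.evalFrom p (S.out q a)) := by
        simp only [SeqTransducer.pullback, Equiv.symm_apply_apply]
      rw [DFA.evalFrom_cons, hstep, ih]
      simp only [SeqTransducer.Produces]
      constructor
      · rintro ⟨y, hy, hacc⟩
        exact ⟨_, ⟨y, rfl, hy⟩, by rwa [DFA.evalFrom_of_append]⟩
      · rintro ⟨_, ⟨y, rfl, hy⟩, hacc⟩
        exact ⟨y, hy, by rwa [DFA.evalFrom_of_append] at hacc⟩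
  exact key x S.start A.start

theorem flatMap_finRange_mul {γ : Type} {m n : ℕ} (f : Fin (m * n) → List γ) :
    (List.finRange (m * n)).flatMap f = (List.finRange m).flatMap fun q =>
      (List.finRange n).flatMap fun p => f (finProdFinEquiv (q, p)) := by
  simp only [List.flatMap_def, ← List.ofFn_eq_map]
  rw [List.ofFn_mul, List.flatten_flatten, List.map_ofFn]
  congr 2
  funext q
  simp only [Function.comp_apply]
  congr 2
  funext p
  congr 1
  ext
  simp [Nat.add_comm, Nat.mul_comm]

theorem exists_lt_iterate_eq {n : ℕ} (h : Fin n → Fin n) (x : Fin n) (t : ℕ) :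
    ∃ t' < n, h^[t'] x = h^[t] x := by
  induction t using Nat.strong_induction_on with
  | _ t ih =>
    rcases lt_or_ge t n with ht | ht
    · exact ⟨t, ht, rfl⟩
    · obtain ⟨i, j, hij, hs⟩ := Fintype.exists_ne_map_eq_of_card_lt
        (fun i : Fin (n + 1) => h^[(i : ℕ)] x) (by simp)
      wlog hlt : i < j generalizing i j
      · exact this j i hij.symm hs.symm (lt_of_le_of_ne (not_lt.1 hlt) hij.symm)
      have hlt' : (i : ℕ) < j := hlt
      have hj := j.2
      obtain ⟨t', ht', he⟩ := ih (t - j + i) (by omega)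
      refine ⟨t', ht', he.trans ?_⟩
      rw [Function.iterate_add_apply, hs, ← Function.iterate_add_apply]
      congr 2
      omega

/-- A word `u v^t` leads to an accepting state for some `t` only if it does so for some `t` below
the number of states, so a bounded search finds it. -/
theorem DFA.exists_evalFrom_pow_iff {n : ℕ} (A : DFA (Fin k) (Fin n)) (p : Fin n)
    (u v : List (Fin k)) :
    (∃ t, A.evalFrom p (u ++ (List.replicate t v).flatten) ∈ A.accept) ↔
      ∃ t < n, (fun s => A.evalFrom s v)^[t] (A.evalFrom p u) ∈ A.accept := by
  have h : ∀ t s, A.evalFrom s (List.replicate t v).flatten = (fun s => A.evalFrom s v)^[t] s := by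
    intro t
    induction t with
    | zero => simp
    | succ t ih =>
      intro s
      rw [List.replicate_succ, List.flatten_cons, DFA.evalFrom_of_append, ih]
      rfl
  simp only [DFA.evalFrom_of_append, h]
  constructor
  · rintro ⟨t, ht⟩
    obtain ⟨t', ht', he⟩ := exists_lt_iterate_eq (fun s => A.evalFrom s v) (A.evalFrom p u) t
    exact ⟨t', ht', by rwa [he]⟩
  · rintro ⟨t, -, ht⟩
    exact ⟨t, ht⟩

end Product

/-! ### Parsing encodings of automata -/

theorem unary_succ (v : ℕ) : unary (v + 1) = true :: unary v := rfl

/-- Reads a number below `n` in unary; the value is the remaining word. -/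
def scan : ℕ → List Bool → Option (List Bool)
  | _, [] => none
  | 0, _ => none
  | _ + 1, false :: t => some t
  | n + 1, true :: t => scan n t

/-- Reads `k` numbers below `n`. -/
def scans (n : ℕ) : ℕ → List Bool → Option (List Bool)
  | 0, t => some t
  | k + 1, t => (scan n t).bind (scans n k)

/-- Reads the description of a state of an automaton with `n` states and `k` letters. -/
def scanState (n k : ℕ) : List Bool → Option (List Bool)
  | [] => none
  | _ :: t => scans n k t

/-- Reads the descriptions of `j` states of an automaton with `n` states and `k` letters. -/
def scanStates (n k : ℕ) : ℕ → List Bool → Option (List Bool)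
  | 0, t => some t
  | j + 1, t => (scanState n k t).bind (scanStates n k j)

theorem scan_eq_some {n : ℕ} {s t : List Bool} :
    scan n s = some t ↔ ∃ v < n, s = unary v ++ t := by
  induction s generalizing n with
  | nil => simp [scan, unary]
  | cons b s ih =>
    cases n with
    | zero => simp [scan]
    | succ n =>
      cases b with
      | false =>
        simp only [scan, Option.some.injEq]
        constructor
        · rintro rfl
          exact ⟨0, by omega, rfl⟩
        · rintro ⟨_ | v, -, h⟩
          · simpa [unary] using h
          · simp [unary_succ] at h
      | true =>
        simp only [scan, ih]
        constructor
        · rintro ⟨v, hv, rfl⟩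
          exact ⟨v + 1, by omega, rfl⟩
        · rintro ⟨_ | v, hv, h⟩
          · simp [unary] at h
          · exact ⟨v, by omega, by simpa [unary_succ] using h⟩

theorem scans_eq_some {n k : ℕ} {s t : List Bool} :
    scans n k s = some t ↔
      ∃ v : Fin k → Fin n, s = ((List.finRange k).flatMap fun a => unary (v a)) ++ t := by
  induction k generalizing s with
  | zero => simp [scans]
  | succ k ih =>
    simp only [scans, Option.bind_eq_some_iff, scan_eq_some, ih, List.finRange_succ,
      List.flatMap_cons, List.flatMap_map]
    constructor
    · rintro ⟨_, ⟨v, hv, rfl⟩, vs, rfl⟩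
      exact ⟨Fin.cons ⟨v, hv⟩ vs, by simp⟩
    · rintro ⟨v, rfl⟩
      exact ⟨_, ⟨v 0, (v 0).2, List.append_assoc _ _ _⟩, fun a => v a.succ, rfl⟩

theorem scanStates_eq_some {n k j : ℕ} {s t : List Bool} :
    scanStates n k j s = some t ↔ ∃ (b : Fin j → Bool) (v : Fin j → Fin k → Fin n),
      s = ((List.finRange j).flatMap fun q =>
        b q :: (List.finRange k).flatMap fun a => unary (v q a)) ++ t := by
  induction j generalizing s with
  | zero => simp [scanStates]
  | succ j ih =>
    cases s with
    | nil => simp [scanStates, scanState, List.finRange_succ]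
    | cons b s =>
      simp only [scanStates, scanState, Option.bind_eq_some_iff, scans_eq_some, ih,
        List.finRange_succ, List.flatMap_cons, List.flatMap_map]
      constructor
      · rintro ⟨_, ⟨v, rfl⟩, bs, vs, rfl⟩
        exact ⟨Fin.cons b bs, Fin.cons v vs, by simp⟩
      · rintro ⟨bs, vs, h⟩
        simp only [List.cons_append, List.cons.injEq, List.append_assoc] at h
        obtain ⟨rfl, rfl⟩ := h
        exact ⟨_, ⟨vs 0, rfl⟩, fun q => bs q.succ, fun q => vs q.succ, rfl⟩

theorem unary_append_inj {u v : ℕ} {s t : List Bool} (h : unary u ++ s = unary v ++ t) :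
    u = v ∧ s = t := by
  induction u generalizing v with
  | zero =>
    cases v with
    | zero => exact ⟨rfl, by simpa [unary] using h⟩
    | succ v => simp [unary, List.replicate_succ] at h
  | succ u ih =>
    cases v with
    | zero => simp [unary, List.replicate_succ] at h
    | succ v =>
      simp only [unary_succ, List.cons_append, List.cons.injEq, true_and] at h
      exact ⟨congrArg _ (ih h).1, (ih h).2⟩

theorem flatMap_append_inj {γ δ : Type} {j : ℕ} {f : γ → List δ}
    (hf : ∀ c c' s s', f c ++ s = f c' ++ s' → c = c' ∧ s = s') {v v' : Fin j → γ} {s s' : List δ}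
    (h : ((List.finRange j).flatMap fun a => f (v a)) ++ s =
      ((List.finRange j).flatMap fun a => f (v' a)) ++ s') : v = v' ∧ s = s' := by
  induction j with
  | zero => exact ⟨Subsingleton.elim _ _, by simpa using h⟩
  | succ j ih =>
    simp only [List.finRange_succ, List.flatMap_cons, List.flatMap_map, List.append_assoc] at h
    obtain ⟨h0, h1⟩ := hf _ _ _ _ h
    obtain ⟨h2, h3⟩ := ih h1
    refine ⟨funext fun a => ?_, h3⟩
    cases a using Fin.cases with
    | zero => exact h0
    | succ a => exact congrFun h2 a

theorem encodeDFA_size_eq {k n n' : ℕ} {A : DFA (Fin k) (Fin n)} {t : List Bool}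
    (h : encodeDFA A = unary n' ++ t) : n = n' := by
  rw [encodeDFA, List.append_assoc] at h
  exact (unary_append_inj h).1

theorem encodeDFA_injective {k n : ℕ} :
    Function.Injective (encodeDFA : DFA (Fin k) (Fin n) → List Bool) := by
  intro A A' h
  classical
  simp only [encodeDFA, List.append_assoc] at h
  obtain ⟨h1, h2⟩ := unary_append_inj (unary_append_inj h).2
  have h3 := (flatMap_append_inj (γ := Bool × (Fin k → Fin n)) (s := []) (s' := [])
    (f := fun c => c.1 :: (List.finRange k).flatMap fun a => unary (c.2 a))
    (v := fun q => (decide (q ∈ A.accept), A.step q))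
    (v' := fun q => (decide (q ∈ A'.accept), A'.step q)) ?_ ?_).1
  · obtain ⟨step, start, accept⟩ := A
    obtain ⟨step', start', accept'⟩ := A'
    obtain rfl : start = start' := Fin.ext h1
    obtain rfl : step = step' := funext fun q => (Prod.ext_iff.1 (congrFun h3 q)).2
    obtain rfl : accept = accept' := by
      ext q
      exact decide_eq_decide.1 (Prod.ext_iff.1 (congrFun h3 q)).1
    rfl
  · rintro ⟨b, v⟩ ⟨b', v'⟩ s s' hs
    simp only [List.cons_append, List.cons.injEq] at hs
    obtain ⟨rfl, hs⟩ := hs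
    obtain ⟨rfl, rfl⟩ := flatMap_append_inj (f := fun c : Fin n => unary c)
      (fun c c' s s' h => ⟨Fin.ext (unary_append_inj h).1, (unary_append_inj h).2⟩) hs
    exact ⟨rfl, rfl⟩
  · simpa using h2

theorem exists_eq_encodeDFA_iff {k n : ℕ} {t : List Bool} :
    (∃ A : DFA (Fin k) (Fin n), unary n ++ t = encodeDFA A) ↔
      (scan n t).bind (scanStates n k n) = some [] := by
  classical
  simp only [Option.bind_eq_some_iff, scan_eq_some, scanStates_eq_some, encodeDFA,
    List.append_assoc, List.append_cancel_left_eq, List.append_nil]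
  constructor
  · rintro ⟨A, rfl⟩
    exact ⟨_, ⟨A.start, A.start.2, rfl⟩, _, _, rfl⟩
  · rintro ⟨_, ⟨v, hv, rfl⟩, b, vs, rfl⟩
    exact ⟨⟨vs, ⟨v, hv⟩, {q | b q = true}⟩, by simp⟩

/-! ### Total correctness of register programs -/

namespace RegProg

section Triples

variable {ι : Type} [DecidableEq ι] {w : List Bool} {N : ℕ}

/-- Total correctness: from every state in `P`, the program `c` terminates in a state in `Q`, with
registers bounded by `N`. -/
def Triple (w : List Bool) (N : ℕ) (P : RegState ι Bool → Prop) (c : RegProg ι Bool Bool)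
    (Q : RegState ι Bool → Prop) : Prop :=
  ∀ s, P s → ∃ s', Exec w N c s s' ∧ Q s'

/-- The states with position in `P`, registers `r` and output `o`. -/
def Here (P : ℕ → Prop) (r : ι → ℕ) (o : List Bool) (s : RegState ι Bool) : Prop :=
  P s.pos ∧ s.reg = r ∧ s.out = o

/-- No condition on the position of the input head. -/
abbrev anywhere : ℕ → Prop := fun _ => True

/-- The positions of the input head from which on `w` reads `t`. -/
def suffix (w t : List Bool) (i : ℕ) : Prop := 1 ≤ i ∧ w.drop (i - 1) = t

theorem Triple.seq {P Q R : RegState ι Bool → Prop} {a b : RegProg ι Bool Bool}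
    (ha : Triple w N P a Q) (hb : Triple w N Q b R) : Triple w N P (.seq a b) R := by
  intro s hs
  obtain ⟨s', h1, h2⟩ := ha s hs
  obtain ⟨s'', h3, h4⟩ := hb s' h2
  exact ⟨s'', .seq h1 h3, h4⟩

theorem Triple.weaken {r' : ι → ℕ} {o' : List Bool} {c : RegProg ι Bool Bool}
    {Q : RegState ι Bool → Prop} {P' : ℕ → Prop} (h : Triple w N Q c (Here P' r' o')) :
    Triple w N Q c (Here anywhere r' o') :=
  fun s hs => (h s hs).imp fun _ h => ⟨h.1, trivial, h.2.2⟩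

theorem triple_skip {P : RegState ι Bool → Prop} : Triple w N P .skip P :=
  fun s hs => ⟨s, .skip s, hs⟩

theorem triple_op {P : ℕ → Prop} {r r' : ι → ℕ} {o : List Bool} {a : RegOp ι}
    (ha : a.Admissible N r) (hr : a.eval r = r') :
    Triple w N (Here P r o) (.op a) (Here P r' o) := by
  subst hr
  rintro ⟨i, _, _⟩ ⟨hi, rfl, rfl⟩
  exact ⟨_, .op _ _ ha, hi, rfl, rfl⟩

theorem triple_emit {P : ℕ → Prop} {r : ι → ℕ} {o : List Bool} (b : Bool) :
    Triple w N (Here P r o) (.emit b) (Here P r (o ++ [b])) := by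
  rintro ⟨i, _, _⟩ ⟨hi, rfl, rfl⟩
  exact ⟨_, .emit _ _, hi, rfl, rfl⟩

theorem suffix.inputAt {t : List Bool} {i : ℕ} (h : suffix w t i) :
    OfflineTM.inputAt w i = t.head?.elim .rightEnd .letter := by
  obtain ⟨h1, h2⟩ := h
  obtain ⟨j, rfl⟩ : ∃ j, i = j + 1 := ⟨i - 1, by omega⟩
  simp only [OfflineTM.inputAt]
  rw [Nat.add_sub_cancel] at h2
  rw [← List.head?_drop, h2]
  cases t <;> rfl

theorem suffix.moveInput {b : Bool} {t : List Bool} {i : ℕ} (h : suffix w (b :: t) i) :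
    suffix w t (OfflineTM.moveInput w i .right) := by
  obtain ⟨h1, h2⟩ := h
  obtain ⟨j, rfl⟩ : ∃ j, i = j + 1 := ⟨i - 1, by omega⟩
  have hlen := congrArg List.length h2
  simp only [Nat.add_sub_cancel, List.length_drop, List.length_cons] at hlen h2
  have hmin : OfflineTM.moveInput w (j + 1) .right = j + 2 := by
    simp only [OfflineTM.moveInput]
    omega
  rw [hmin]
  refine ⟨by omega, ?_⟩
  have : w.drop (j + 1) = (w.drop j).tail := by rw [List.tail_drop]
  simpa [h2] using this

theorem triple_move_right {b : Bool} {t : List Bool} {r : ι → ℕ} {o : List Bool} :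
    Triple w N (Here (suffix w (b :: t)) r o) (.move .right) (Here (suffix w t) r o) := by
  rintro ⟨i, _, _⟩ ⟨hi, rfl, rfl⟩
  exact ⟨_, .move _ _, hi.moveInput, rfl, rfl⟩

theorem triple_branch_true {P Q : RegState ι Bool → Prop} {t : RegTest ι Bool}
    {a b : RegProg ι Bool Bool} (ht : ∀ s, P s → t.eval w s = true) (h : Triple w N P a Q) :
    Triple w N P (.branch t a b) Q :=
  fun s hs => (h s hs).imp fun _ h => ⟨.branchTrue (ht s hs) h.1, h.2⟩

theorem triple_branch_false {P Q : RegState ι Bool → Prop} {t : RegTest ι Bool}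
    {a b : RegProg ι Bool Bool} (ht : ∀ s, P s → t.eval w s = false) (h : Triple w N P b Q) :
    Triple w N P (.branch t a b) Q :=
  fun s hs => (h s hs).imp fun _ h => ⟨.branchFalse (ht s hs) h.1, h.2⟩

theorem triple_loop_true {P Q R : RegState ι Bool → Prop} {t : RegTest ι Bool}
    {a : RegProg ι Bool Bool} (ht : ∀ s, P s → t.eval w s = true) (ha : Triple w N P a Q)
    (hl : Triple w N Q (.loop t a) R) : Triple w N P (.loop t a) R := by
  intro s hs
  obtain ⟨s', h1, h2⟩ := ha s hs
  obtain ⟨s'', h3, h4⟩ := hl s' h2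
  exact ⟨s'', .loopTrue (ht s hs) h1 h3, h4⟩

theorem triple_loop_false {P : RegState ι Bool → Prop} {t : RegTest ι Bool}
    {a : RegProg ι Bool Bool} (ht : ∀ s, P s → t.eval w s = false) :
    Triple w N P (.loop t a) P :=
  fun s hs => ⟨s, .loopFalse (ht s hs), hs⟩

/-- Executes `f a` for all `a` in a fixed list. -/
def each {γ : Type} (f : γ → RegProg ι Bool Bool) : List γ → RegProg ι Bool Bool
  | [] => .skip
  | a :: l => .seq (f a) (each f l)

theorem triple_each_emit {γ : Type} {f : γ → RegProg ι Bool Bool} {g : γ → List Bool}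
    {P : ℕ → Prop} {r : ι → ℕ}
    (h : ∀ a o, Triple w N (Here P r o) (f a) (Here P r (o ++ g a))) (l : List γ) (o : List Bool) :
    Triple w N (Here P r o) (each f l) (Here P r (o ++ l.flatMap g)) := by
  induction l generalizing o with
  | nil => simpa [each] using triple_skip
  | cons a l ih =>
    have := (h a o).seq (ih (o ++ g a))
    simpa [each, List.append_assoc] using this

/-- Executes `a` as many times as the value of register `i`. -/
def countdown (i : ι) (a : RegProg ι Bool Bool) : RegProg ι Bool Bool :=
  .loop (.pos i) (.seq (.op (.dec i)) a)

theorem triple_countdown {i : ι} {a : RegProg ι Bool Bool} (I : ℕ → RegState ι Bool → Prop) (m : ℕ)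
    (hI : ∀ j s, I j s → s.reg i = j)
    (ha : ∀ j < m, ∀ s, I (j + 1) s →
      ∃ s', Exec w N a { s with reg := Function.update s.reg i j } s' ∧ I j s') :
    Triple w N (I m) (countdown i a) (I 0) := by
  induction m with
  | zero => exact triple_loop_false fun s hs => by simp [RegTest.eval, hI _ _ hs]
  | succ m ih =>
    intro s hs
    have hm := hI _ _ hs
    obtain ⟨s', h1, h2⟩ := ha m (by omega) s hs
    obtain ⟨s'', h3, h4⟩ := ih (fun j hj => ha j (by omega)) s' h2
    refine ⟨s'', .loopTrue (by simp [RegTest.eval, hm]) (.seq (.op _ _ ?_) ?_) h3, h4⟩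
    · simp [RegOp.Admissible, hm]
    · simpa [RegOp.eval, hm] using h1

theorem triple_countdown_here {i : ι} {a : RegProg ι Bool Bool} (P : ℕ → ℕ → Prop)
    (r : ℕ → ι → ℕ) (o : ℕ → List Bool) (m : ℕ) (hr : ∀ j, r j i = j)
    (ha : ∀ j < m, Triple w N (Here (P (j + 1)) (Function.update (r (j + 1)) i j) (o (j + 1))) a
      (Here (P j) (r j) (o j))) :
    Triple w N (Here (P m) (r m) (o m)) (countdown i a) (Here (P 0) (r 0) (o 0)) := by
  refine triple_countdown (fun j => Here (P j) (r j) (o j)) m (fun j s hs => ?_) ?_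
  · rw [hs.2.1, hr]
  · rintro j hj s ⟨h1, h2, h3⟩
    exact ha j hj _ ⟨h1, by rw [h2], h3⟩

end Triples

/-! ### Reading numbers -/

/-- The scanned symbol is the letter `true`. -/
def isTrue : InputSymbol Bool → Bool
  | .letter b => b
  | _ => false

/-- The scanned symbol is the letter `false`. -/
def isFalse : InputSymbol Bool → Bool
  | .letter b => !b
  | _ => false

/-- The scanned symbol is the right end marker. -/
def isEnd : InputSymbol Bool → Bool
  | .rightEnd => true
  | _ => false

/-- The scanned symbol is not the left end marker. -/
def notLeftEnd : InputSymbol Bool → Bool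
  | .leftEnd => false
  | _ => true

section Reading

variable {ι : Type} [DecidableEq ι] {w : List Bool} {N : ℕ}

/-- Moves the input head to the first letter. -/
def rewind : RegProg ι Bool Bool :=
  .seq (.loop (.sees notLeftEnd) (.move .left)) (.move .right)

theorem triple_rewind {r : ι → ℕ} {o t : List Bool} (ht : w = t) :
    Triple w N (Here anywhere r o) rewind (Here (suffix w t) r o) := by
  subst ht
  have h : Triple w N (Here anywhere r o) (.loop (.sees notLeftEnd) (.move .left))
      (Here (fun i => i = 0) r o) := by
    rintro ⟨i, _, _⟩ ⟨-, rfl, rfl⟩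
    induction i with
    | zero => exact ⟨_, .loopFalse rfl, rfl, rfl, rfl⟩
    | succ i ih =>
      obtain ⟨s', h1, h2⟩ := ih
      refine ⟨s', .loopTrue ?_ (.move _ _) h1, h2⟩
      simp only [RegTest.eval, OfflineTM.inputAt]
      cases w[i]? <;> rfl
  refine h.seq ?_
  rintro ⟨i, _, _⟩ ⟨hi, rfl, rfl⟩
  dsimp only at hi
  subst hi
  refine ⟨_, .move _ _, ?_, rfl, rfl⟩
  simp [suffix, OfflineTM.moveInput]

/-- Moves the input head behind a number in unary. -/
def skipNumber : RegProg ι Bool Bool :=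
  .seq (.loop (.sees isTrue) (.move .right)) (.move .right)

theorem triple_skipNumber {r : ι → ℕ} {o t : List Bool} (v : ℕ) :
    Triple w N (Here (suffix w (unary v ++ t)) r o) skipNumber (Here (suffix w t) r o) := by
  refine Triple.seq (Q := Here (suffix w (false :: t)) r o) ?_ triple_move_right
  induction v with
  | zero => exact triple_loop_false fun s hs => by simp [RegTest.eval, hs.1.inputAt, unary, isTrue]
  | succ v ih =>
    refine triple_loop_true (fun s hs => ?_) triple_move_right ih
    simp [RegTest.eval, hs.1.inputAt, unary_succ, isTrue]

theorem triple_skipNumbers {γ : Type} {r : ι → ℕ} {o t : List Bool} (f : γ → ℕ) (l : List γ) :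
    Triple w N (Here (suffix w ((l.flatMap fun a => unary (f a)) ++ t)) r o)
      (each (fun _ => skipNumber) l) (Here (suffix w t) r o) := by
  induction l with
  | nil => exact triple_skip
  | cons a l ih =>
    rw [List.flatMap_cons, List.append_assoc]
    exact (triple_skipNumber _).seq ih

/-- Counts the letters `true` up to the next other symbol in register `i`. -/
def readNumber (i : ι) : RegProg ι Bool Bool :=
  .seq (.op (.clear i)) (.loop (.sees isTrue) (.seq (.op (.inc i)) (.move .right)))

theorem triple_readNumber {i : ι} {r : ι → ℕ} {o t : List Bool} {v : ℕ} (hv : v ≤ N)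
    (ht : t.head? ≠ some true) :
    Triple w N (Here (suffix w (List.replicate v true ++ t)) r o) (readNumber i)
      (Here (suffix w t) (Function.update r i v) o) := by
  refine (triple_op (by trivial) rfl).seq (Q := Here _ (Function.update r i 0) o) ?_
  suffices h : ∀ a, a + v ≤ N → Triple w N
      (Here (suffix w (List.replicate v true ++ t)) (Function.update r i a) o)
      (.loop (.sees isTrue) (.seq (.op (.inc i)) (.move .right)))
      (Here (suffix w t) (Function.update r i (a + v)) o) by
    simpa using h 0 (by omega)
  clear hv
  induction v with
  | zero =>
    refine fun a _ => triple_loop_false fun s hs => ?_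
    have := hs.1.inputAt
    rcases t with _ | ⟨_ | _, t⟩ <;> simp_all [RegTest.eval, isTrue]
  | succ v ih =>
    intro a ha
    refine triple_loop_true (fun s hs => ?_) (Triple.seq (triple_op (r' := Function.update r i
      (a + 1)) ?_ ?_) triple_move_right) ?_
    · simp [RegTest.eval, hs.1.inputAt, List.replicate_succ, isTrue]
    · simp only [RegOp.Admissible, Function.update_self]
      omega
    · simp [RegOp.eval]
    · have := ih (a + 1) (by omega)
      rwa [Nat.add_assoc, Nat.add_comm 1] at this

end Reading

end RegProg

/-! ### Validating the input -/

/-- The registers of the reduction. -/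
inductive Reg
  /-- number of states of the given automaton -/
  | n
  /-- number of states of the given automaton still to be treated -/
  | c
  /-- the current state of the given automaton -/
  | p
  /-- a state reached from `p`; also the number of states still to be validated -/
  | x
  /-- auxiliary counter -/
  | y
  /-- auxiliary counter -/
  | z
  /-- a flag: the input is invalid, or the current state of the product is accepting -/
  | e
  deriving DecidableEq

instance : Finite Reg :=
  Set.finite_univ_iff.1 ((Set.toFinite {.n, .c, .p, .x, .y, .z, .e}).subset fun i _ => by
    cases i <;> simp)

/-- Register contents. -/
def regs (n c p x y z e : ℕ) : Reg → ℕ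
  | .n => n
  | .c => c
  | .p => p
  | .x => x
  | .y => y
  | .z => z
  | .e => e

section Regs

variable (n c p x y z e v : ℕ)

@[simp] theorem regs_n : regs n c p x y z e .n = n := rfl
@[simp] theorem regs_c : regs n c p x y z e .c = c := rfl
@[simp] theorem regs_p : regs n c p x y z e .p = p := rfl
@[simp] theorem regs_x : regs n c p x y z e .x = x := rfl
@[simp] theorem regs_y : regs n c p x y z e .y = y := rfl
@[simp] theorem regs_z : regs n c p x y z e .z = z := rfl
@[simp] theorem regs_e : regs n c p x y z e .e = e := rfl

@[simp] theorem update_regs_n :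
    Function.update (regs n c p x y z e) .n v = regs v c p x y z e := by
  funext i; cases i <;> rfl

@[simp] theorem update_regs_c :
    Function.update (regs n c p x y z e) .c v = regs n v p x y z e := by
  funext i; cases i <;> rfl

@[simp] theorem update_regs_p :
    Function.update (regs n c p x y z e) .p v = regs n c v x y z e := by
  funext i; cases i <;> rfl

@[simp] theorem update_regs_x :
    Function.update (regs n c p x y z e) .x v = regs n c p v y z e := by
  funext i; cases i <;> rfl

@[simp] theorem update_regs_y :
    Function.update (regs n c p x y z e) .y v = regs n c p x v z e := by
  funext i; cases i <;> rfl

@[simp] theorem update_regs_z :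
    Function.update (regs n c p x y z e) .z v = regs n c p x y v e := by
  funext i; cases i <;> rfl

@[simp] theorem update_regs_e :
    Function.update (regs n c p x y z e) .e v = regs n c p x y z v := by
  funext i; cases i <;> rfl

end Regs

namespace RegProg

section Validation

variable {w : List Bool} {N : ℕ}

/-- Sets the flag. -/
def setFlag : RegProg Reg Bool Bool := .seq (.op (.clear .e)) (.op (.inc .e))

theorem exec_setFlag (hN : 1 ≤ N) {i n c p x y z e : ℕ} {o : List Bool} :
    Exec w N setFlag ⟨i, regs n c p x y z e, o⟩ ⟨i, regs n c p x y z 1, o⟩ := by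
  have h1 : Exec w N (.op (.clear .e)) ⟨i, regs n c p x y z e, o⟩
      (⟨i, regs n c p x y z 0, o⟩ : RegState Reg Bool) := by
    simpa [RegOp.eval] using Exec.op (w := w) (N := N) (α := Bool) (.clear .e)
      (⟨i, regs n c p x y z e, o⟩ : RegState Reg Bool) trivial
  have h2 : Exec w N (.op (.inc .e)) ⟨i, regs n c p x y z 0, o⟩
      (⟨i, regs n c p x y z 1, o⟩ : RegState Reg Bool) := by
    simpa [RegOp.eval] using Exec.op (w := w) (N := N) (α := Bool) (.inc .e)
      (⟨i, regs n c p x y z 0, o⟩ : RegState Reg Bool)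
      (by simpa [RegOp.Admissible] using Nat.lt_of_succ_le hN)
  exact .seq h1 h2

/-- The state of the validation when `o` is what remains of the input, or `none` if an error has
been found. -/
def Scanned (w : List Bool) (n x : ℕ) (o : Option (List Bool)) (s : RegState Reg Bool) : Prop :=
  ∃ i y e, 1 ≤ i ∧ s = ⟨i, regs n 0 0 x y 0 e, []⟩ ∧
    o = if e = 0 then some (w.drop (i - 1)) else none

/-- The end of `checkNumber`, after all letters `true` of the number have been read. -/
def checkTerminator : RegProg Reg Bool Bool :=
  .seq (.branch (.sees isFalse) (.branch (.pos .y) .skip setFlag) setFlag) (.move .right)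

/-- Checks that a number in unary follows that is less than the value of register `n`. After an
error, the flag is set and the scan goes on. -/
def checkNumber : RegProg Reg Bool Bool :=
  .seq (.op (.copy .y .n)) (.seq
    (.loop (.sees isTrue) (.seq (.branch (.pos .y) (.op (.dec .y)) setFlag) (.move .right)))
    checkTerminator)

theorem suffix.moveInput_tail {t : List Bool} {i : ℕ} (h : suffix w t i) :
    suffix w t.tail (OfflineTM.moveInput w i .right) := by
  cases t with
  | cons b t => exact h.moveInput
  | nil =>
    obtain ⟨h1, h2⟩ := h
    have := List.drop_eq_nil_iff.1 h2
    refine ⟨by simp only [OfflineTM.moveInput]; omega, List.drop_eq_nil_iff.2 ?_⟩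
    simp only [OfflineTM.moveInput]
    omega

theorem exec_checkTerminator (hN : 1 ≤ N) {t : List Bool} {i n x y e : ℕ} (hi : suffix w t i)
    (ht : t.head? ≠ some true) :
    ∃ s', Exec w N checkTerminator ⟨i, regs n 0 0 x y 0 e, []⟩ s' ∧
      Scanned w n x ((if e = 0 then some t else none).bind (scan y)) s' := by
  have hm := hi.moveInput_tail
  have hin := hi.inputAt
  rcases t with _ | ⟨_ | _, t⟩
  · refine ⟨_, .seq (.branchFalse ?_ (exec_setFlag hN)) (.move _ _), _, y, 1, hm.1, rfl, ?_⟩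
    · simp [RegTest.eval, hin, isFalse]
    · by_cases h : e = 0 <;> simp_all [scan]
  · rcases y with _ | y
    · refine ⟨_, .seq (.branchTrue ?_ (.branchFalse ?_ (exec_setFlag hN))) (.move _ _), _, 0, 1,
        hm.1, rfl, ?_⟩
      · simp [RegTest.eval, hin, isFalse]
      · simp [RegTest.eval]
      · by_cases h : e = 0 <;> simp_all [scan]
    · refine ⟨_, .seq (.branchTrue ?_ (.branchTrue ?_ (.skip _))) (.move _ _), _, y + 1, e, hm.1,
        rfl, ?_⟩
      · simp [RegTest.eval, hin, isFalse]
      · simp [RegTest.eval]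
      · rw [hm.2]
        by_cases h : e = 0 <;> simp_all [scan]
  · simp at ht

theorem exec_checkNumber_loop (hN : 1 ≤ N) (t : List Bool) : ∀ {i n x y e : ℕ}, suffix w t i →
    ∃ s', Exec w N (.seq
      (.loop (.sees isTrue) (.seq (.branch (.pos .y) (.op (.dec .y)) setFlag) (.move .right)))
      checkTerminator) ⟨i, regs n 0 0 x y 0 e, []⟩ s' ∧
      Scanned w n x ((if e = 0 then some t else none).bind (scan y)) s' := by
  induction t with
  | nil =>
    intro i n x y e hi
    obtain ⟨s', h1, h2⟩ := exec_checkTerminator (n := n) (x := x) (y := y) (e := e) hN hi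
        (by simp)
    exact ⟨s', .seq (.loopFalse (by simp [RegTest.eval, hi.inputAt, isTrue])) h1, h2⟩
  | cons b t ih =>
    intro i n x y e hi
    cases b with
    | false =>
      obtain ⟨s', h1, h2⟩ := exec_checkTerminator (n := n) (x := x) (y := y) (e := e) hN hi
        (by simp)
      exact ⟨s', .seq (.loopFalse (by simp [RegTest.eval, hi.inputAt, isTrue])) h1, h2⟩
    | true =>
      have hin : RegTest.eval w (⟨i, regs n 0 0 x y 0 e, []⟩ : RegState Reg Bool)
        (.sees isTrue) = true := by simp [RegTest.eval, hi.inputAt, isTrue]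
      cases y with
      | zero =>
        obtain ⟨s', h1, h2⟩ := ih (n := n) (x := x) (y := 0) (e := 1) hi.moveInput
        cases h1 with
        | seq h3 h4 =>
          refine ⟨s', .seq (.loopTrue hin (.seq (.branchFalse ?_ (exec_setFlag hN))
            (.move _ _)) h3) h4, ?_⟩
          · simp [RegTest.eval]
          · by_cases h : e = 0 <;> simp_all [scan]
      | succ y =>
        obtain ⟨s', h1, h2⟩ := ih (n := n) (x := x) (y := y) (e := e) hi.moveInput
        cases h1 with
        | seq h3 h4 =>
          refine ⟨s', .seq (.loopTrue hin (.seq (.branchTrue ?_ (.op _ _ ?_)) (.move _ _)) ?_) h4,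
            ?_⟩
          · simp [RegTest.eval]
          · simp [RegOp.Admissible]
          · simpa [RegOp.eval] using h3
          · by_cases h : e = 0 <;> simp_all [scan]

theorem triple_checkNumber (hN : 1 ≤ N) {n x : ℕ} {o : Option (List Bool)} :
    Triple w N (Scanned w n x o) checkNumber (Scanned w n x (o.bind (scan n))) := by
  rintro _ ⟨i, y, e, hi, rfl, rfl⟩
  obtain ⟨s', h1, h2⟩ := exec_checkNumber_loop (w := w) hN _ (n := n) (x := x) (y := n) (e := e)
    ⟨hi, rfl⟩
  refine ⟨s', .seq (.op _ _ trivial) ?_, h2⟩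
  simpa [RegOp.eval] using h1

theorem triple_checkNumbers (hN : 1 ≤ N) {n x : ℕ} {γ : Type} (l : List γ) :
    ∀ {o : Option (List Bool)}, Triple w N (Scanned w n x o) (each (fun _ => checkNumber) l)
      (Scanned w n x (o.bind (scans n l.length))) := by
  induction l with
  | nil =>
    intro o
    simpa [scans, each] using triple_skip
  | cons a l ih =>
    intro o
    have := (triple_checkNumber (w := w) (n := n) (x := x) (o := o) hN).seq ih
    rwa [Option.bind_assoc] at this

/-- Checks that the description of a state follows. -/
def checkState (k : ℕ) : RegProg Reg Bool Bool :=
  .seq (.branch (.sees isEnd) setFlag (.move .right))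
    (each (fun _ => checkNumber) (List.finRange k))

theorem triple_checkState (hN : 1 ≤ N) {n x : ℕ} (k : ℕ) {o : Option (List Bool)} :
    Triple w N (Scanned w n x o) (checkState k) (Scanned w n x (o.bind (scanState n k))) := by
  have h : Triple w N (Scanned w n x o) (.branch (.sees isEnd) setFlag (.move .right))
      (Scanned w n x (o.bind fun t => if t = [] then none else some t.tail)) := by
    rintro _ ⟨i, y, e, hi, rfl, rfl⟩
    have hs : suffix w (w.drop (i - 1)) i := ⟨hi, rfl⟩
    have hin := hs.inputAt
    have hm := hs.moveInput_tail
    by_cases hnil : w.drop (i - 1) = []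
    · refine ⟨_, .branchTrue ?_ (exec_setFlag hN), _, y, 1, hi, rfl, ?_⟩
      · simp [RegTest.eval, hin, hnil, isEnd]
      · by_cases h : e = 0 <;> simp_all
    · refine ⟨_, .branchFalse ?_ (.move _ _), _, y, e, hm.1, rfl, ?_⟩
      · obtain ⟨b, t, hbt⟩ := List.exists_cons_of_ne_nil hnil
        simp [RegTest.eval, hin, hbt, isEnd]
      · rw [hm.2]
        by_cases h : e = 0 <;> simp_all
  have := h.seq (triple_checkNumbers hN (List.finRange k))
  rw [Option.bind_assoc] at this
  have hscan : scanState n k = fun t =>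
      (if t = [] then none else some t.tail).bind (scans n (List.finRange k).length) := by
    funext t
    cases t <;> simp [scanState]
  rwa [hscan]

/-- Checks that the input describes an automaton with `k` letters, and stores its number of states
in register `n`. -/
def validate (k : ℕ) : RegProg Reg Bool Bool :=
  .seq rewind (.seq (readNumber .n) (.seq (.branch (.sees isFalse) (.move .right) setFlag)
    (.seq checkNumber (.seq (.op (.copy .x .n)) (.seq (countdown .x (checkState k))
      (.branch (.sees isEnd) .skip setFlag))))))

theorem exists_eq_replicate_append (w : List Bool) :
    ∃ n t, w = List.replicate n true ++ t ∧ t.head? ≠ some true := by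
  induction w with
  | nil => exact ⟨0, [], by simp⟩
  | cons b w ih =>
    cases b with
    | false => exact ⟨0, false :: w, by simp⟩
    | true =>
      obtain ⟨n, t, rfl, ht⟩ := ih
      exact ⟨n + 1, t, by simp [List.replicate_succ], ht⟩

/-- The flag tells whether the input encodes an automaton. -/
theorem triple_validate (w : List Bool) (k : ℕ) :
    ∃ i n y e, Exec w (w.length + 1) (validate k) ⟨0, regs 0 0 0 0 0 0 0, []⟩
      ⟨i, regs n 0 0 0 y 0 e, []⟩ ∧
      (e = 0 ↔ ∃ (m : ℕ) (A : DFA (Fin k) (Fin m)), w = encodeDFA A) ∧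
      ∀ (m : ℕ) (A : DFA (Fin k) (Fin m)), w = encodeDFA A → m = n := by
  obtain ⟨n, t, hw, ht⟩ := exists_eq_replicate_append w
  have hN : 1 ≤ w.length + 1 := by omega
  have hn : n ≤ w.length + 1 := by
    have := congrArg List.length hw
    simp at this
    omega
  set o : Option (List Bool) := if t = [] then none else some t.tail with ho
  have h1 : Triple w (w.length + 1) (Here anywhere (regs 0 0 0 0 0 0 0) []) rewind
      (Here (suffix w (List.replicate n true ++ t)) (regs 0 0 0 0 0 0 0) []) :=
    triple_rewind hw
  have h2 := triple_readNumber (i := Reg.n) (w := w) (r := regs 0 0 0 0 0 0 0) (o := []) hn ht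
  rw [update_regs_n] at h2
  have h3 : Triple w (w.length + 1) (Here (suffix w t) (regs n 0 0 0 0 0 0) [])
      (.branch (.sees isFalse) (.move .right) setFlag) (Scanned w n 0 o) := by
    rintro ⟨i, _, _⟩ ⟨hi, rfl, rfl⟩
    have hin := hi.inputAt
    have hm := hi.moveInput_tail
    dsimp only at hi hin hm
    rcases t with _ | ⟨_ | _, t⟩
    · refine ⟨_, .branchFalse ?_ (exec_setFlag hN), _, 0, 1, hi.1, rfl, ?_⟩
      · simp [RegTest.eval, hin, isFalse]
      · simp [ho]
    · refine ⟨_, .branchTrue ?_ (.move _ _), _, 0, 0, hm.1, rfl, ?_⟩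
      · simp [RegTest.eval, hin, isFalse]
      · rw [hm.2]
        simp [ho]
    · simp at ht
  have h4 := triple_checkNumber (w := w) (n := n) (x := 0) (o := o) hN
  have h5 : Triple w (w.length + 1) (Scanned w n 0 (o.bind (scan n))) (.op (.copy .x .n))
      (Scanned w n n (o.bind (scan n))) := by
    rintro _ ⟨i, y, e, hi, rfl, h⟩
    exact ⟨_, .op _ _ trivial, i, y, e, hi, by simp [RegOp.eval], h⟩
  have h6 : Triple w (w.length + 1) (Scanned w n n (o.bind (scan n))) (countdown .x (checkState k))
      (Scanned w n 0 ((o.bind (scan n)).bind (scanStates n k n))) := by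
    have := triple_countdown (w := w) (N := w.length + 1) (i := Reg.x) (a := checkState k)
      (fun j s => ∃ o', Scanned w n j o' s ∧
        o'.bind (scanStates n k j) = (o.bind (scan n)).bind (scanStates n k n)) n ?_ ?_
    · intro s hs
      obtain ⟨s', h, o', ho', he⟩ := this s ⟨_, hs, rfl⟩
      refine ⟨s', h, ?_⟩
      rw [← he]
      simpa [scanStates] using ho'
    · rintro j s ⟨o', ⟨i, y, e, hi, rfl, -⟩, -⟩
      rfl
    · rintro j - s ⟨o', ⟨i, y, e, hi, rfl, ho'⟩, he⟩
      obtain ⟨s', h, hs'⟩ := triple_checkState hN k (x := j) ⟨i, regs n 0 0 j y 0 e, []⟩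
        ⟨i, y, e, hi, rfl, ho'⟩
      refine ⟨s', by simpa using h, _, hs', ?_⟩
      rw [← he, Option.bind_assoc]
      rfl
  have h7 : ∀ o', Triple w (w.length + 1) (Scanned w n 0 o') (.branch (.sees isEnd) .skip setFlag)
      (fun s => ∃ i y e, s = ⟨i, regs n 0 0 0 y 0 e, []⟩ ∧ (e = 0 ↔ o' = some [])) := by
    rintro _ _ ⟨i, y, e, hi, rfl, rfl⟩
    have hs : suffix w (w.drop (i - 1)) i := ⟨hi, rfl⟩
    have hin := hs.inputAt
    by_cases hnil : w.drop (i - 1) = []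
    · refine ⟨_, .branchTrue ?_ (.skip _), i, y, e, rfl, ?_⟩
      · simp [RegTest.eval, hin, hnil, isEnd]
      · simp [hnil]
    · refine ⟨_, .branchFalse ?_ (exec_setFlag hN), i, y, 1, rfl, ?_⟩
      · obtain ⟨b, t, hbt⟩ := List.exists_cons_of_ne_nil hnil
        simp [RegTest.eval, hin, hbt, isEnd]
      · by_cases h : e = 0 <;> simp_all
  obtain ⟨_, hexec, i, y, e, rfl, he⟩ :=
    (h1.seq (h2.seq (h3.seq (h4.seq (h5.seq (h6.seq (h7 _)))))))
      ⟨0, regs 0 0 0 0 0 0 0, []⟩ ⟨trivial, rfl, rfl⟩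
  have hvalid : (∃ (m : ℕ) (A : DFA (Fin k) (Fin m)), w = encodeDFA A) ↔
      (o.bind (scan n)).bind (scanStates n k n) = some [] := by
    rcases t with _ | ⟨_ | _, t⟩
    · simp only [ho, if_true, Option.bind_none, reduceCtorEq, iff_false]
      rintro ⟨m, A, h⟩
      have hmem : false ∈ w := by rw [h]; simp [encodeDFA, unary]
      rw [hw] at hmem
      simp at hmem
    · have hw' : w = unary n ++ t := by rw [hw]; simp [unary]
      have ho' : o = some t := by simp [ho]
      rw [ho', Option.bind_some, ← exists_eq_encodeDFA_iff, ← hw']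
      constructor
      · rintro ⟨m, A, h⟩
        obtain rfl := encodeDFA_size_eq (h.symm.trans hw')
        exact ⟨A, h⟩
      · rintro ⟨A, h⟩
        exact ⟨_, A, h⟩
    · simp at ht
  have hsize : ∀ (m : ℕ) (A : DFA (Fin k) (Fin m)), w = encodeDFA A → m = n := by
    intro m A h
    rcases t with _ | ⟨_ | _, t⟩
    · have := hvalid.1 ⟨m, A, h⟩
      simp [ho] at this
    · refine encodeDFA_size_eq (t := t) (A := A) ?_
      rw [← h, hw]
      simp [unary]
    · simp at ht
  exact ⟨i, n, y, e, hexec, he.trans hvalid.symm, hsize⟩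

end Validation

end RegProg

/-! ### Writing the product automaton -/

open Classical in
/-- The description of the state `q` in the encoding of an automaton. -/
noncomputable def stateWord {k n : ℕ} (A : DFA (Fin k) (Fin n)) (q : Fin n) : List Bool :=
  decide (q ∈ A.accept) :: (List.finRange k).flatMap fun a => unary (A.step q a)

theorem encodeDFA_eq {k n : ℕ} (A : DFA (Fin k) (Fin n)) :
    encodeDFA A = unary n ++ (unary A.start ++ (List.finRange n).flatMap (stateWord A)) := by
  rw [← List.append_assoc]
  rfl

theorem size_le_length_encodeDFA {k n : ℕ} (A : DFA (Fin k) (Fin n)) :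
    n ≤ (encodeDFA A).length := by
  rw [encodeDFA_eq]
  simp [unary]

theorem drop_finRange_flatMap {γ : Type} {n i : ℕ} (hi : i < n) (f : Fin n → List γ) :
    ((List.finRange n).drop i).flatMap f =
      f ⟨i, hi⟩ ++ ((List.finRange n).drop (i + 1)).flatMap f := by
  rw [List.drop_eq_getElem_cons (by simpa using hi), List.flatMap_cons]
  simp

theorem take_finRange_flatMap {γ : Type} {n i : ℕ} (hi : i < n) (f : Fin n → List γ) :
    ((List.finRange n).take (i + 1)).flatMap f =
      ((List.finRange n).take i).flatMap f ++ f ⟨i, hi⟩ := by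
  rw [List.take_succ_eq_append_getElem (by simpa using hi), List.flatMap_append]
  simp

namespace RegProg

section Lookup

variable {k n N : ℕ} {A : DFA (Fin k) (Fin n)}

/-- Moves the input head to the description of the state in register `y`, which is cleared. -/
def gotoState (k : ℕ) : RegProg Reg Bool Bool :=
  .seq rewind (.seq skipNumber (.seq skipNumber
    (countdown .y (.seq (.move .right) (each (fun _ => skipNumber) (List.finRange k))))))

theorem triple_gotoState {m c p x z e : ℕ} {o : List Bool} (q : Fin n) :
    Triple (encodeDFA A) N (Here anywhere (regs m c p x q z e) o) (gotoState k)
      (Here (suffix (encodeDFA A) (((List.finRange n).drop q).flatMap (stateWord A)))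
        (regs m c p x 0 z e) o) := by
  refine (triple_rewind (encodeDFA_eq A)).seq
    ((triple_skipNumber _).seq ((triple_skipNumber _).seq ?_))
  have := triple_countdown_here (w := encodeDFA A) (N := N) (i := Reg.y)
    (a := .seq (.move .right) (each (fun _ => skipNumber) (List.finRange k)))
    (fun j => suffix (encodeDFA A) (((List.finRange n).drop (q - j)).flatMap (stateWord A)))
    (fun j => regs m c p x j z e) (fun _ => o) q (fun j => rfl) ?_
  · simpa using this
  · intro j hj
    have hq := q.2
    rw [drop_finRange_flatMap (by omega : (q : ℕ) - (j + 1) < n),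
      show (q : ℕ) - (j + 1) + 1 = q - j by omega, update_regs_y]
    exact triple_move_right.seq (triple_skipNumbers _ _)

/-- Replaces the state in register `x` by its successor under the letter `b`. -/
def applyLetter (b : Fin k) : RegProg Reg Bool Bool :=
  .seq (.op (.copy .y .x)) (.seq (gotoState k) (.seq (.move .right)
    (.seq (each (fun _ => skipNumber) ((List.finRange k).take b)) (readNumber .x))))

theorem triple_applyLetter (hN : n ≤ N) {m c p y z e : ℕ} {o : List Bool} (q : Fin n) (b : Fin k) :
    Triple (encodeDFA A) N (Here anywhere (regs m c p q y z e) o) (applyLetter b)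
      (Here anywhere (regs m c p (A.step q b) 0 z e) o) := by
  refine (triple_op (r' := regs m c p q q z e) (by trivial) (by simp [RegOp.eval])).seq
    ((triple_gotoState q).seq ?_)
  rw [drop_finRange_flatMap q.2, stateWord]
  have hsplit : ((List.finRange k).flatMap fun a => unary (A.step q a)) =
      (((List.finRange k).take b).flatMap fun a => unary (A.step q a)) ++
        (unary (A.step q b) ++
          ((List.finRange k).drop (b + 1)).flatMap fun a => unary (A.step q a)) := by
    conv_lhs => rw [← List.take_append_drop b (List.finRange k)]
    rw [List.flatMap_append, drop_finRange_flatMap b.2]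
  rw [hsplit, List.cons_append, List.append_assoc]
  refine triple_move_right.seq ((triple_skipNumbers _ _).seq ?_)
  rw [unary, List.append_assoc, List.append_assoc]
  have := triple_readNumber (w := encodeDFA A) (i := Reg.x) (r := regs m c p q 0 z e) (o := o)
    (v := A.step q b) ((A.step q b).2.le.trans hN)
    (t := [false] ++ ((((List.finRange k).drop (b + 1)).flatMap fun a => unary (A.step q a)) ++
      ((List.finRange n).drop (q + 1)).flatMap (stateWord A))) (by simp)
  rw [update_regs_x] at this
  exact this.weaken

/-- Replaces the state in register `x` by the state reached from it under a fixed word. -/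
def applyWord (u : List (Fin k)) : RegProg Reg Bool Bool := each applyLetter u

theorem triple_applyWord (hN : n ≤ N) {m c p z e : ℕ} {o : List Bool} (u : List (Fin k)) :
    ∀ q : Fin n, Triple (encodeDFA A) N (Here anywhere (regs m c p q 0 z e) o) (applyWord u)
      (Here anywhere (regs m c p (A.evalFrom q u) 0 z e) o) := by
  induction u with
  | nil => exact fun q => triple_skip
  | cons b u ih =>
    intro q
    rw [DFA.evalFrom_cons]
    exact (triple_applyLetter hN q b).seq (ih _)

/-- Sets the flag if the state in register `x` is accepting. -/
def checkAccept (k : ℕ) : RegProg Reg Bool Bool :=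
  .seq (.op (.copy .y .x)) (.seq (gotoState k) (.branch (.sees isTrue) setFlag .skip))

open Classical in
theorem triple_checkAccept (hN : n ≤ N) {m c p z e : ℕ} {o : List Bool} (q : Fin n) :
    Triple (encodeDFA A) N (Here anywhere (regs m c p q 0 z e) o) (checkAccept k)
      (Here anywhere (regs m c p q 0 z (if q ∈ A.accept then 1 else e)) o) := by
  refine (triple_op (r' := regs m c p q q z e) (by trivial) (by simp [RegOp.eval])).seq
    ((triple_gotoState q).seq ?_)
  rw [drop_finRange_flatMap q.2, stateWord]
  have hq := q.2
  by_cases h : q ∈ A.accept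
  · refine triple_branch_true (fun s hs => by simp [RegTest.eval, hs.1.inputAt, isTrue, h]) ?_
    rintro ⟨i, _, _⟩ ⟨-, rfl, rfl⟩
    rw [if_pos h]
    exact ⟨_, exec_setFlag (by omega), trivial, rfl, rfl⟩
  · refine triple_branch_false (fun s hs => by simp [RegTest.eval, hs.1.inputAt, isTrue, h]) ?_
    rw [if_neg h]
    exact triple_skip.weaken

/-- Sets the flag if a word in `u v*` leads from the state in register `p` to an accepting state. -/
def checkPowers (uv : List (Fin k) × List (Fin k)) : RegProg Reg Bool Bool :=
  .seq (.op (.copy .x .p)) (.seq (applyWord uv.1) (.seq (.op (.copy .z .n))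
    (.seq (countdown .z (.seq (checkAccept k) (applyWord uv.2))) (.op (.clear .x)))))

open Classical in
theorem triple_checkPowers (hN : n ≤ N) {c e : ℕ} {o : List Bool} (p : Fin n)
    (uv : List (Fin k) × List (Fin k)) :
    Triple (encodeDFA A) N (Here anywhere (regs n c p 0 0 0 e) o) (checkPowers uv)
      (Here anywhere (regs n c p 0 0 0
        (if ∃ t, A.evalFrom p (uv.1 ++ (List.replicate t uv.2).flatten) ∈ A.accept
          then 1 else e)) o) := by
  refine (triple_op (r' := regs n c p p 0 0 e) (by trivial) (by simp [RegOp.eval])).seq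
    ((triple_applyWord hN uv.1 p).seq ((triple_op
      (r' := regs n c p (A.evalFrom p uv.1) 0 n e) (by trivial) (by simp [RegOp.eval])).seq ?_))
  set h : Fin n → Fin n := fun s => A.evalFrom s uv.2
  set s₀ := A.evalFrom p uv.1
  -- After `i` rounds, the flag tells whether one of the first `i` states was accepting.
  have key := triple_countdown_here (w := encodeDFA A) (N := N) (i := Reg.z)
    (a := .seq (checkAccept k) (applyWord uv.2)) (fun _ => anywhere)
    (fun j => regs n c p (h^[n - j] s₀) 0 j (if ∃ t < n - j, h^[t] s₀ ∈ A.accept then 1 else e))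
    (fun _ => o) n (fun j => rfl) ?_
  · refine Triple.seq ?_ (triple_op (r := regs n c p (h^[n] s₀) 0 0
      (if ∃ t < n, h^[t] s₀ ∈ A.accept then 1 else e)) (by trivial) ?_)
    · simpa using key
    · rw [if_congr (A.exists_evalFrom_pow_iff p uv.1 uv.2) rfl rfl]
      simp only [RegOp.eval, update_regs_x]
      rfl
  · intro j hj
    rw [update_regs_z]
    refine (triple_checkAccept hN _).seq ?_
    have hstep : n - j = (n - (j + 1)) + 1 := by omega
    have hflag : (if h^[n - (j + 1)] s₀ ∈ A.accept then 1 else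
        if ∃ t < n - (j + 1), h^[t] s₀ ∈ A.accept then 1 else e) =
        if ∃ t < n - j, h^[t] s₀ ∈ A.accept then 1 else e := by
      rw [hstep]
      by_cases hacc : h^[n - (j + 1)] s₀ ∈ A.accept
      · rw [if_pos hacc, if_pos ⟨_, Nat.lt_succ_self _, hacc⟩]
      · rw [if_neg hacc]
        refine if_congr ⟨fun ⟨t, ht, h'⟩ => ⟨t, by omega, h'⟩, fun ⟨t, ht, h'⟩ =>
          ⟨t, lt_of_le_of_ne (by omega) ?_, h'⟩⟩ rfl rfl
        rintro rfl
        exact hacc h'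
    rw [hflag]
    have := triple_applyWord (A := A) hN (m := n) (c := c) (p := p) (z := j) (o := o)
      (e := if ∃ t < n - j, h^[t] s₀ ∈ A.accept then 1 else e) uv.2 (h^[n - (j + 1)] s₀)
    have hit : h^[n - j] s₀ = A.evalFrom (h^[n - (j + 1)] s₀) uv.2 := by
      rw [hstep, Function.iterate_succ_apply']
    rwa [← hit] at this

/-- Writes the bit that tells whether one of the languages `u v*` contains a word that leads from
the state in register `p` to an accepting state. -/
def emitAccept (E : List (List (Fin k) × List (Fin k))) : RegProg Reg Bool Bool :=
  .seq (each checkPowers E) (.seq (.branch (.pos .e) (.emit true) (.emit false)) (.op (.clear .e)))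

open Classical in
theorem triple_emitAccept (hN : n ≤ N) {c : ℕ} {o : List Bool} (p : Fin n)
    (E : List (List (Fin k) × List (Fin k))) :
    Triple (encodeDFA A) N (Here anywhere (regs n c p 0 0 0 0) o) (emitAccept E)
      (Here anywhere (regs n c p 0 0 0 0) (o ++ [decide (∃ uv ∈ E, ∃ t,
        A.evalFrom p (uv.1 ++ (List.replicate t uv.2).flatten) ∈ A.accept)])) := by
  have h : ∀ e, Triple (encodeDFA A) N (Here anywhere (regs n c p 0 0 0 e) o) (each checkPowers E)
      (Here anywhere (regs n c p 0 0 0 (if ∃ uv ∈ E, ∃ t,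
        A.evalFrom p (uv.1 ++ (List.replicate t uv.2).flatten) ∈ A.accept then 1 else e)) o) := by
    induction E with
    | nil => simpa [each] using fun e => triple_skip
    | cons uv E ih =>
      intro e
      have := (triple_checkPowers hN (c := c) (e := e) (o := o) p uv).seq (ih _)
      refine (congrArg (fun e => Triple _ _ _ _ (Here anywhere (regs n c p 0 0 0 e) o)) ?_).mp this
      rw [if_congr (List.exists_mem_cons_iff _ _ _) rfl rfl]
      by_cases h1 : ∃ t, A.evalFrom p (uv.1 ++ (List.replicate t uv.2).flatten) ∈ A.accept
      · rw [if_pos h1, if_pos (Or.inl h1), ite_self]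
      · rw [if_neg h1]
        exact if_congr (or_iff_right h1).symm rfl rfl
  refine (h 0).seq ?_
  split_ifs with hacc
  · refine Triple.seq (triple_branch_true (fun s hs => ?_) (triple_emit true)) ?_
    · simp [RegTest.eval, hs.2.1]
    · rw [decide_eq_true hacc]
      exact triple_op (by trivial) (by simp [RegOp.eval])
  · refine Triple.seq (triple_branch_false (fun s hs => ?_) (triple_emit false)) ?_
    · simp [RegTest.eval, hs.2.1]
    · rw [decide_eq_false hacc]
      exact triple_op (by trivial) (by simp [RegOp.eval])

end Lookup

section Output

variable {w : List Bool} {N : ℕ}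

/-- Writes the value of register `i` in unary, without the final `false`. -/
def emitRegister (i : Reg) : RegProg Reg Bool Bool :=
  .seq (.op (.copy .y i)) (countdown .y (.emit true))

theorem triple_emitRegister {P : ℕ → Prop} {r : Reg → ℕ} {o : List Bool} (i : Reg)
    (hr : r .y = 0) :
    Triple w N (Here P r o) (emitRegister i) (Here P r (o ++ List.replicate (r i) true)) := by
  refine (triple_op (r' := Function.update r .y (r i)) (by trivial) rfl).seq ?_
  have := triple_countdown_here (w := w) (N := N) (i := Reg.y) (a := .emit true)
    (fun _ => P) (fun j => Function.update r .y j)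
    (fun j => o ++ List.replicate (r i - j) true) (r i) (by simp) ?_
  · have h0 : Function.update r .y 0 = r := by rw [← hr, Function.update_eq_self]
    simpa [h0] using this
  · intro j hj
    have := triple_emit (w := w) (N := N) (P := P) (r := Function.update r .y j)
      (o := o ++ List.replicate (r i - (j + 1)) true) true
    rw [Function.update_idem]
    rwa [List.append_assoc, ← List.replicate_succ', show r i - (j + 1) + 1 = r i - j by omega]
      at this

/-- Writes `x + n * q` in unary, where `x` and `n` are registers. -/
def emitIndex (q : ℕ) : RegProg Reg Bool Bool :=
  .seq (each (fun _ => emitRegister .n) (List.finRange q))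
    (.seq (emitRegister .x) (.emit false))

theorem triple_emitIndex {P : ℕ → Prop} {n c p x z e : ℕ} {o : List Bool} (q : ℕ) :
    Triple w N (Here P (regs n c p x 0 z e) o) (emitIndex q)
      (Here P (regs n c p x 0 z e) (o ++ unary (x + n * q))) := by
  have h := triple_each_emit (w := w) (N := N) (P := P) (r := regs n c p x 0 z e)
    (f := fun _ : Fin q => emitRegister .n) (g := fun _ => List.replicate n true)
    (fun _ _ => triple_emitRegister .n rfl) (List.finRange q) o
  have hrep : ∀ q : ℕ, ((List.finRange q).flatMap fun _ => List.replicate n true) =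
      List.replicate (n * q) true := by
    intro q
    induction q with
    | zero => rfl
    | succ q ih =>
      rw [List.finRange_succ, List.flatMap_cons, List.flatMap_map, ih, ← List.replicate_add,
        Nat.mul_succ, Nat.add_comm]
  have := h.seq ((triple_emitRegister .x rfl).seq (triple_emit false))
  rw [hrep, regs_x] at this
  rwa [List.append_assoc, List.append_assoc, ← List.append_assoc (List.replicate (n * q) true),
    ← List.replicate_add, Nat.add_comm (n * q)] at this

end Output

section Generate

variable {l k : ℕ} (S : SeqTransducer l k) {n N : ℕ} {A : DFA (Fin k) (Fin n)}

/-- Writes the number of the successor under the letter `a` of the state of the product that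
consists of `q` and the state in register `p`. -/
def emitSuccessor (q : Fin S.m) (a : Fin l) : RegProg Reg Bool Bool :=
  .seq (.op (.copy .x .p)) (.seq (applyWord (S.out q a))
    (.seq (emitIndex (S.next q a)) (.op (.clear .x))))

theorem triple_emitSuccessor (hN : n ≤ N) {c : ℕ} {o : List Bool} (q : Fin S.m) (a : Fin l)
    (p : Fin n) :
    Triple (encodeDFA A) N (Here anywhere (regs n c p 0 0 0 0) o) (emitSuccessor S q a)
      (Here anywhere (regs n c p 0 0 0 0)
        (o ++ unary (A.evalFrom p (S.out q a) + n * S.next q a))) :=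
  (triple_op (r' := regs n c p p 0 0 0) (by trivial) (by simp [RegOp.eval])).seq
    ((triple_applyWord hN _ p).seq ((triple_emitIndex _).seq
      (triple_op (by trivial) (by simp [RegOp.eval]))))

/-- Writes the description of the state of the product that consists of `q` and the state in
register `p`. -/
def emitState (q : Fin S.m) : RegProg Reg Bool Bool :=
  .seq (emitAccept (S.final q)) (each (emitSuccessor S q) (List.finRange l))

theorem stateWord_pullback (q : Fin S.m) (p : Fin n) :
    stateWord (S.pullback A) (finProdFinEquiv (q, p)) =
      open Classical in
      [decide (∃ uv ∈ S.final q, ∃ t,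
        A.evalFrom p (uv.1 ++ (List.replicate t uv.2).flatten) ∈ A.accept)] ++
      (List.finRange l).flatMap fun a => unary (A.evalFrom p (S.out q a) + n * S.next q a) := by
  refine congrArg₂ List.cons (decide_eq_decide.2 ?_) ?_
  · simp only [SeqTransducer.pullback, Set.mem_ofPred_eq, Equiv.symm_apply_apply]
  · simp only [SeqTransducer.pullback, Equiv.symm_apply_apply, finProdFinEquiv_apply_val]
    rfl

theorem triple_emitState (hN : n ≤ N) {c : ℕ} {o : List Bool} (q : Fin S.m) (p : Fin n) :
    Triple (encodeDFA A) N (Here anywhere (regs n c p 0 0 0 0) o) (emitState S q)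
      (Here anywhere (regs n c p 0 0 0 0)
        (o ++ stateWord (S.pullback A) (finProdFinEquiv (q, p)))) := by
  rw [stateWord_pullback, ← List.append_assoc]
  exact (triple_emitAccept hN p _).seq
    (triple_each_emit (fun a _ => triple_emitSuccessor S hN q a p) _ _)

/-- Writes the descriptions of all states of the product with first component `q`. -/
def emitRow (q : Fin S.m) : RegProg Reg Bool Bool :=
  .seq (.op (.copy .c .n)) (.seq (countdown .c (.seq (emitState S q) (.op (.inc .p))))
    (.op (.clear .p)))

theorem triple_emitRow (hN : n ≤ N) (q : Fin S.m) (o : List Bool) :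
    Triple (encodeDFA A) N (Here anywhere (regs n 0 0 0 0 0 0) o) (emitRow S q)
      (Here anywhere (regs n 0 0 0 0 0 0) (o ++ (List.finRange n).flatMap fun p =>
        stateWord (S.pullback A) (finProdFinEquiv (q, p)))) := by
  refine (triple_op (r' := regs n n 0 0 0 0 0) (by trivial) (by simp [RegOp.eval])).seq
    (Triple.seq (Q := Here anywhere (regs n 0 n 0 0 0 0) (o ++ (List.finRange n).flatMap fun p =>
        stateWord (S.pullback A) (finProdFinEquiv (q, p)))) ?_
      (triple_op (by trivial) (by simp [RegOp.eval])))
  have := triple_countdown_here (w := encodeDFA A) (N := N) (i := Reg.c)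
    (a := .seq (emitState S q) (.op (.inc .p))) (fun _ => anywhere)
    (fun j => regs n j (n - j) 0 0 0 0)
    (fun j => o ++ ((List.finRange n).take (n - j)).flatMap fun p =>
        stateWord (S.pullback A) (finProdFinEquiv (q, p))) n (fun j => rfl) ?_
  · have htake : (List.finRange n).take n = List.finRange n :=
      List.take_of_length_le (by simp)
    simpa [htake] using this
  · intro j hj
    have hstep : n - j = (n - (j + 1)) + 1 := by omega
    have hlt : n - (j + 1) < n := by omega
    rw [update_regs_c, hstep, take_finRange_flatMap hlt, ← List.append_assoc]
    refine (triple_emitState S hN q ⟨n - (j + 1), hlt⟩).seq (triple_op ?_ ?_)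
    · simp only [RegOp.Admissible, regs_p]
      omega
    · simp [RegOp.eval]

/-- Writes the encoding of the product automaton. -/
def emitPullback : RegProg Reg Bool Bool :=
  .seq (.op (.clear .y)) (.seq (emitIndex S.m) (.seq rewind (.seq skipNumber (.seq (readNumber .x)
    (.seq (emitIndex S.start) (.seq (.op (.clear .x)) (each (emitRow S) (List.finRange S.m))))))))

theorem encodeDFA_pullback : encodeDFA (S.pullback A) = unary (0 + n * S.m) ++
    (unary (A.start + n * S.start) ++ (List.finRange S.m).flatMap fun q =>
      (List.finRange n).flatMap fun p => stateWord (S.pullback A) (finProdFinEquiv (q, p))) := by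
  rw [encodeDFA_eq, flatMap_finRange_mul, Nat.zero_add, Nat.mul_comm n]
  rfl

theorem triple_emitPullback (hN : n ≤ N) {y : ℕ} :
    Triple (encodeDFA A) N (Here anywhere (regs n 0 0 0 y 0 0) []) (emitPullback S)
      (Here anywhere (regs n 0 0 0 0 0 0) (encodeDFA (S.pullback A))) := by
  refine (triple_op (r' := regs n 0 0 0 0 0 0) (by trivial) (by simp [RegOp.eval])).seq
    ((triple_emitIndex S.m).seq ((triple_rewind (encodeDFA_eq A)).seq ?_))
  refine (triple_skipNumber _).seq ?_
  have hread := triple_readNumber (w := encodeDFA A) (i := Reg.x) (r := regs n 0 0 0 0 0 0)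
    (o := [] ++ unary (0 + n * S.m)) (v := A.start) (A.start.2.le.trans hN)
    (t := [false] ++ (List.finRange n).flatMap (stateWord A)) (by simp)
  rw [update_regs_x] at hread
  rw [unary, List.append_assoc]
  refine hread.weaken.seq ((triple_emitIndex S.start).seq
    ((triple_op (r' := regs n 0 0 0 0 0 0) (by trivial) (by simp [RegOp.eval])).seq ?_))
  have := triple_each_emit (fun q o => triple_emitRow S hN q o (A := A)) (List.finRange S.m)
    ([] ++ unary (0 + n * S.m) ++ unary (A.start + n * S.start))
  rwa [List.nil_append, List.append_assoc, ← encodeDFA_pullback] at this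

/-- Writes the encoding of the product automaton if the input is valid, and nothing
otherwise. -/
def reduction : RegProg Reg Bool Bool :=
  .seq (validate k) (.branch (.pos .e) .skip (emitPullback S))

/-- The run of the reduction; injectivity of the encoding makes the output independent of the
automaton chosen for a valid input. -/
theorem exec_reduction (w : List Bool) :
    ∃ s, Exec w (w.length + 1) (reduction S) ⟨0, fun _ => 0, []⟩ s ∧
      (∀ (n : ℕ) (A : DFA (Fin k) (Fin n)), w = encodeDFA A →
        s.out = encodeDFA (S.pullback A)) ∧
      ((¬ ∃ (n : ℕ) (A : DFA (Fin k) (Fin n)), w = encodeDFA A) → s.out = []) := by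
  have hinit : (fun _ => 0 : Reg → ℕ) = regs 0 0 0 0 0 0 0 := by
    funext i; cases i <;> rfl
  rw [hinit]
  obtain ⟨i, n, y, e, hexec, he, hn⟩ := triple_validate w k
  by_cases hv : ∃ (n : ℕ) (A : DFA (Fin k) (Fin n)), w = encodeDFA A
  · obtain rfl := he.2 hv
    obtain ⟨m, A, rfl⟩ := hv
    obtain rfl := hn m A rfl
    obtain ⟨s, hs, hs'⟩ := triple_emitPullback (A := A) S
      ((size_le_length_encodeDFA A).trans (Nat.le_succ _)) ⟨i, regs m 0 0 0 y 0 0, []⟩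
      ⟨trivial, rfl, rfl⟩
    refine ⟨s, .seq hexec (.branchFalse (by simp [RegTest.eval]) hs), ?_, fun h => ?_⟩
    · intro n' A' h
      obtain rfl := hn n' A' h
      rw [← encodeDFA_injective h]
      exact hs'.2.2
    · exact absurd ⟨m, A, rfl⟩ h
  · refine ⟨_, .seq hexec (.branchTrue ?_ (.skip _)), fun n' A h => absurd ⟨n', A, h⟩ hv,
      fun _ => rfl⟩
    have : e ≠ 0 := fun h => hv (he.1 h)
    exact decide_eq_true (Nat.pos_of_ne_zero this)

end Generate

end RegProg

/-! ### The reduction between regular realizability problems -/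

theorem nil_notMem_RR {k : ℕ} (F : Language (Fin k)) : [] ∉ RR F := by
  rintro ⟨n, A, h, -⟩
  rw [encodeDFA_eq] at h
  simp [unary] at h

theorem FST.IsDeterministic.exists_logspaceReduction {k l : ℕ} {T : FST (Fin l) (Fin k)}
    (hT : T.IsDeterministic) (F : Language (Fin l)) :
    ∃ f : List Bool → List Bool, IsLogspaceReduction f (RR (T.image F)) (RR F) ∧
      ∀ (n : ℕ) (A : DFA (Fin k) (Fin n)), ∃ (m : ℕ) (B : DFA (Fin l) (Fin m)),
        f (encodeDFA A) = encodeDFA B ∧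
        ∀ x, x ∈ B.accepts ↔ ∃ y, T.Realizes x y ∧ y ∈ A.accepts := by
  obtain ⟨S, hS⟩ := hT.exists_seqTransducer
  have hacc : ∀ {n : ℕ} (A : DFA (Fin k) (Fin n)) (x : List (Fin l)),
      x ∈ (S.pullback A).accepts ↔ ∃ y, T.Realizes x y ∧ y ∈ A.accepts := by
    intro n A x
    simp only [S.mem_accepts_pullback, hS]
  choose s hexec hvalid hinvalid using RegProg.exec_reduction S
  refine ⟨fun w => (s w).out, ⟨?_, fun w => ?_⟩, fun n A =>
    ⟨_, S.pullback A, hvalid _ n A rfl, hacc A⟩⟩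
  · exact logspaceComputable_of_exec (RegProg.reduction S) fun w => ⟨s w, hexec w, rfl⟩
  · by_cases h : ∃ (n : ℕ) (A : DFA (Fin k) (Fin n)), w = encodeDFA A
    · obtain ⟨n, A, rfl⟩ := h
      change _ ↔ (s (encodeDFA A)).out ∈ RR F
      rw [hvalid _ n A rfl]
      constructor
      · rintro ⟨n', A', h, y, hy, x, hx, hxy⟩
        refine ⟨_, S.pullback A', ?_, x, (hacc A' x).2 ⟨y, hxy, hy⟩, hx⟩
        rw [← hvalid _ n A rfl, hvalid _ n' A' h]
      · rintro ⟨m, B, h, x, hx, hxF⟩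
        obtain rfl : S.m * n = m := by
          rw [encodeDFA_eq B] at h
          exact encodeDFA_size_eq h
        rw [← encodeDFA_injective h] at hx
        obtain ⟨y, hxy, hy⟩ := (hacc A x).1 hx
        exact ⟨n, A, rfl, y, hy, x, hxF, hxy⟩
    · simp only [hinvalid w h, nil_notMem_RR, iff_false]
      rintro ⟨n, A, hA, -⟩
      exact h ⟨n, A, hA⟩

theorem mainTheorem5 {k l : ℕ} (F₁ : Language (Fin k)) (F₂ : Language (Fin l)) :
    (DFSTReducible F₁ F₂ → LogspaceReducible (RR F₁) (RR F₂)) ∧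
    (∀ T : FST (Fin l) (Fin k), T.IsDeterministic → F₁ = T.image F₂ →
      ∃ f : List Bool → List Bool, IsLogspaceReduction f (RR F₁) (RR F₂) ∧
        ∀ (n : ℕ) (A : DFA (Fin k) (Fin n)), ∃ (m : ℕ) (B : DFA (Fin l) (Fin m)),
          f (encodeDFA A) = encodeDFA B ∧
          ∀ x, x ∈ B.accepts ↔ ∃ y, T.Realizes x y ∧ y ∈ A.accepts) := by
  refine ⟨?_, ?_⟩
  · rintro ⟨T, hT, rfl⟩
    obtain ⟨f, hf, -⟩ := hT.exists_logspaceReduction F₂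
    exact ⟨f, hf⟩
  · rintro T hT rfl
    exact hT.exists_logspaceReduction F₂
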